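/- **Setting.** Let $\mathcal V$ be a finite set of edge devices and let $\Phi=[0,1]^D$ be the context space with the Euclidean norm. In each round $t=1,2,\dots$ there are given a set $\mathcal V^t\subseteq\mathcal V$ of available devices, a context $\phi^t_\nu\in\Phi$ for each $\nu\in\mathcal V^t$, a budget $b^t\in\mathbb N$, a deadline $d^t$ and the recovery threshold $Y^t=(k-1)\deg(f_t)+1$ (where $k\ge 1$ is the number of data blocks and $f_t$ the polynomial to be computed on each of them). Device $\nu$ has a random service delay $c^t_\nu$; put $q^t_\nu=\mathbb 1\{c^t_\nu\le d^t\}$. The $q^t_\nu$ are independent over rounds and devices, and $\mathbb P(q^t_\nu=1)=\mu(\phi^t_\nu)$ for a function $\mu:\Phi\to[0,1]$. For a unit cost $\eta\ge 0$ the reward of $\mathcal A\subseteq\mathcal V^t$ is $r(\mathcal A)=\mathbb 1\{\sum_{\nu\in\mathcal A}q^t_\nu\ge Y^t\}-\eta|\mathcal A|$, and for a vector $p=(p_\nu)_\nu$ of probabilities let $$u(p,\mathcal A)=\sum_{j=Y^t}^{|\mathcal A|}\ \sum_{\mathcal A'\subseteq\mathcal A,\,|\mathcal A'|=j}\ \prod_{\nu\in\mathcal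 A'}p_\nu\prod_{\nu\in\mathcal A\setminus\mathcal A'}(1-p_\nu)-\eta|\mathcal A| .$$ Fix integers $0\le s^t\le\min(b^t,|\mathcal V^t|)$ and call $\mathcal A\subseteq\mathcal V^t$ admissible in round $t$ if $s^t\le|\mathcal A|\le b^t$ ($s^t=0$ leaves only the budget constraint; $s^t=Y^t$ keeps only the decisions from which decoding is possible). The *optimal offline policy* with input $p$ sorts $\mathcal V^t$ by decreasing $p_\nu$ and, among the sets of the first $z$ devices, $z=s^t,s^t+1,\dots,b^t$, returns the first one with the largest $u(p,\cdot)$. Let $\mathcal A^{t*}$ be an admissible set with the largest $u(\boldsymbol\mu^t,\cdot)$, where $\boldsymbol\mu^t=(\mu(\phi^t_\nu))_\nu$. **Online policy.** Given the horizon $T$ and parameters $h_T$, $K(t)$, split $\Phi$ into $h_T^D$ hypercubes of side $1/h_T$. Before round $t$ let $C^t(p)$ be the number of past selections of devices with context in the hypercube $p$, and let $\hat\mu^t(p)$ be the fraction of them with $q=1$ (and $0$ if there are none). Let $\mathcal V^{ue,t}$ be the set of $\nu\in\mathcal V^t$ whose hypercube $p$ has $C^t(p)\le K(t)$. If $\mathcal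 V^{ue,t}\ne\emptyset$ and $|\mathcal V^{ue,t}|\ge b^t$, select $b^t$ devices of $\mathcal V^{ue,t}$ at random (in any way). If $\mathcal V^{ue,t}\ne\emptyset$ and $|\mathcal V^{ue,t}|<b^t$, select all of $\mathcal V^{ue,t}$ and fill up the budget, as far as there are devices, with the devices of $\mathcal V^t\setminus\mathcal V^{ue,t}$ that have the largest estimates. If $\mathcal V^{ue,t}=\emptyset$, use the optimal offline policy with the estimates $\hat\mu^t$ as input. Ties are broken in any way, and the randomness of the policy is independent of all $q^t_\nu$. With $\mathcal A^t$ the selected set, the regret is $R(T)=\mathbb E\big[\sum_{t=1}^T r(\mathcal A^{t*})-r(\mathcal A^t)\big]$. **Theorem 1 (Regret Upper Bound).** Assume that there are $L,\alpha>0$ with $|\mu(\phi)-\mu(\phi')|\le L\|\phi-\phi'\|^\alpha$ for all $\phi,\phi'\in\Phi$, and let $h_T=\lceil T^{1/(3\alpha+D)}\rceil$ and $K(t)=t^{2\alpha/(3\alpha+D)}\log t$. Then for every $T\ge 1$, with $B=\max_{1\le t\le T}b^t$ and $M=\max_{1\le t\le T}\binom{B-1}{Y^t-1}$, $$\begin{aligned}R(T)\le{}&(1+\eta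 B)\,2^D\Big(T^{\frac{2\alpha+D}{3\alpha+D}}\log T+T^{\frac{D}{3\alpha+D}}\Big)+(1+\eta B)\,B\,\frac{\pi^2}{3}\sum_{k=1}^{B}\binom{|\mathcal V|}{k}\\&+\Big(3LD^{\alpha/2}+\frac{6\alpha+2D}{2\alpha+D}\Big)BM\,T^{\frac{2\alpha+D}{3\alpha+D}} .\end{aligned}$$ Moreover $R(T)=O\big(T^{\frac{2\alpha+D}{3\alpha+D}}\log T\big)$ as $T\to\infty$, and the policy is asymptotically optimal: $\lim_{T\to\infty}R(T)/T=0$. -/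

import Mathlib

open MeasureTheory ProbabilityTheory Filter Topology Asymptotics

namespace CodedEdge

/-- The context space `[0,1]^D`, with the Euclidean norm of the ambient space. -/
def contextSpace (D : ℕ) : Set (EuclideanSpace ℝ (Fin D)) :=
  {x | ∀ i, 0 ≤ x i ∧ x i ≤ 1}

/-- `f` satisfies the Hölder condition with constants `L`, `α` on the context space. -/
def HolderCondition {D : ℕ} (f : EuclideanSpace ℝ (Fin D) → ℝ) (L α : ℝ) : Prop :=
  ∀ x ∈ contextSpace D, ∀ y ∈ contextSpace D, |f x - f y| ≤ L * ‖x - y‖ ^ α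

/-- The expected reward `u(p, A)` of the set `A` of devices with success probabilities `p`,
recovery threshold `Y` and unit cost `η`. -/
noncomputable def expectedReward {V : Type*} [DecidableEq V] (Y : ℕ) (η : ℝ) (p : V → ℝ)
    (A : Finset V) : ℝ :=
  (∑ j ∈ Finset.Icc Y A.card, ∑ A' ∈ A.powersetCard j,
    (∏ ν ∈ A', p ν) * ∏ ν ∈ A \ A', (1 - p ν)) - η * A.card

/-- The realized reward of the set `A` of devices when the indicators of a timely return
are `q`. -/
noncomputable def reward {V : Type*} (Y : ℕ) (η : ℝ) (q : V → ℕ) (A : Finset V) : ℝ :=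
  (if Y ≤ ∑ ν ∈ A, q ν then 1 else 0) - η * A.card

/-- The deterministic data of an online coded edge computing problem with device set `V` and
contexts of dimension `D`.  The rounds are `t = 1, 2, …`; entries with index `0` and contexts of
unavailable devices are never used. -/
structure System (D : ℕ) (V : Type*) where
  /-- number `k` of the data blocks `X₁, …, X_k` -/
  blocks : ℕ
  one_le_blocks : 1 ≤ blocks
  /-- degree of the map function `f_t` -/
  degree : ℕ → ℕ
  /-- unit cost `η` of using a device -/
  cost : ℝ
  cost_nonneg : 0 ≤ cost
  /-- success probability `μ` as a function of the context -/
  succProb : EuclideanSpace ℝ (Fin D) → ℝ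
  succProb_mem : ∀ x ∈ contextSpace D, 0 ≤ succProb x ∧ succProb x ≤ 1
  /-- available devices -/
  avail : ℕ → Finset V
  /-- context of a device in a round -/
  ctx : ℕ → V → EuclideanSpace ℝ (Fin D)
  ctx_mem : ∀ t, ∀ ν ∈ avail t, ctx t ν ∈ contextSpace D
  /-- largest number `b^t` of devices that may be used -/
  budget : ℕ → ℕ
  /-- smallest number `s^t` of devices of an admissible decision.  The choice `0` gives all
  decisions within the budget; the choice of the recovery threshold gives those decisions from
  which decoding is possible at all. -/
  minSize : ℕ → ℕ
  minSize_le : ∀ t, minSize t ≤ budget t ∧ minSize t ≤ (avail t).card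
  /-- computation deadline -/
  deadline : ℕ → ℝ

namespace System

variable {D : ℕ} {V : Type*}

/-- The recovery threshold `Y^t = (k - 1) deg(f_t) + 1` of Lagrange coded computing. -/
def threshold (S : System D V) (t : ℕ) : ℕ := (S.blocks - 1) * S.degree t + 1

/-- Admissible offloading decisions in round `t`. -/
def Admissible (S : System D V) (t : ℕ) (A : Finset V) : Prop :=
  A ⊆ S.avail t ∧ S.minSize t ≤ A.card ∧ A.card ≤ S.budget t

/-- Success probability of device `ν` in round `t`. -/
def deviceProb (S : System D V) (t : ℕ) (ν : V) : ℝ := S.succProb (S.ctx t ν)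

/-- `A` maximizes the expected reward over all admissible decisions of round `t`. -/
def IsOptimalDecision [DecidableEq V] (S : System D V) (t : ℕ) (A : Finset V) : Prop :=
  S.Admissible t A ∧ ∀ A', S.Admissible t A' →
    expectedReward (S.threshold t) S.cost (S.deviceProb t) A' ≤
      expectedReward (S.threshold t) S.cost (S.deviceProb t) A

/-- The largest budget `B` up to the horizon `T`. -/
def maxBudget (S : System D V) (T : ℕ) : ℕ := (Finset.Icc 1 T).sup S.budget

/-- `M = max_{1 ≤ t ≤ T} C(B - 1, Y^t - 1)`. -/
def maxChoose (S : System D V) (T : ℕ) : ℕ :=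
  (Finset.Icc 1 T).sup fun t => (S.maxBudget T - 1).choose (S.threshold t - 1)

/-- The indicator `q^t_ν` that the service delay `c^t_ν` meets the deadline. -/
noncomputable def success {Ω : Type*} (S : System D V) (c : ℕ → V → Ω → ℝ) (t : ℕ) (ν : V)
    (ω : Ω) : ℕ :=
  if c t ν ω ≤ S.deadline t then 1 else 0

/-- The stochastic model: measurable service delays whose indicators of meeting the deadline are
independent over rounds and devices and have the success probabilities given by the contexts. -/
structure IsDelayModel {Ω : Type*} [MeasurableSpace Ω] (S : System D V) (P : Measure Ω)
    (c : ℕ → V → Ω → ℝ) : Prop where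
  measurable : ∀ t ν, Measurable (c t ν)
  indep : iIndepFun (fun (i : ℕ × V) => S.success c i.1 i.2) P
  prob : ∀ t, 1 ≤ t → ∀ ν ∈ S.avail t,
    P.real {ω | c t ν ω ≤ S.deadline t} = S.deviceProb t ν

end System

/-- Index of the hypercube containing `x` in the partition of `[0,1]^D` into `h^D` hypercubes of
side `1/h`: in each coordinate the intervals are `[j/h, (j+1)/h)` for `j < h - 1`, and
`[(h-1)/h, 1]`. -/
noncomputable def cell {D : ℕ} (h : ℕ) (x : EuclideanSpace ℝ (Fin D)) : Fin D → ℕ :=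
  fun i => min ⌊(h : ℝ) * x i⌋₊ (h - 1)

/-- What the policy remembers of each hypercube: the number of selected devices with context in
it, and how many of those returned their result in time. -/
structure Record (D : ℕ) where
  count : (Fin D → ℕ) → ℕ
  succ : (Fin D → ℕ) → ℕ

/-- The empty record. -/
def Record.empty (D : ℕ) : Record D := ⟨fun _ => 0, fun _ => 0⟩

/-- Estimated success probability of a hypercube (`0` without observations). -/
noncomputable def Record.estimate {D : ℕ} (R : Record D) (p : Fin D → ℕ) : ℝ :=
  (R.succ p : ℝ) / (R.count p : ℝ)

/-- Linear search over the initial segments of length `s, s + 1, …, b` of the list `l` for the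
first one with the largest value of `u`. -/
noncomputable def linearSearch {V : Type*} [DecidableEq V] (u : Finset V → ℝ) (l : List V)
    (s b : ℕ) : Finset V :=
  (List.range' (s + 1) (b - s)).foldl
    (fun best z => if u best < u (l.take z).toFinset then (l.take z).toFinset else best)
    (l.take s).toFinset

namespace System

variable {D : ℕ} {V : Type*} [DecidableEq V]

/-- `A` is an output of the optimal offline policy in round `t` on the success probabilities `p`:
sort the available devices by decreasing `p` (ties in any way) and run the linear search. -/
def IsOfflineOutput (S : System D V) (t : ℕ) (p : V → ℝ) (A : Finset V) : Prop :=
  ∃ l : List V, l.Nodup ∧ l.toFinset = S.avail t ∧ l.Pairwise (fun ν ν' => p ν' ≤ p ν) ∧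
    A = linearSearch (expectedReward (S.threshold t) S.cost p) l (S.minSize t) (S.budget t)

/-- Estimated success probability of device `ν` in round `t`. -/
noncomputable def deviceEstimate (S : System D V) (h t : ℕ) (R : Record D) (ν : V) : ℝ :=
  R.estimate (cell h (S.ctx t ν))

/-- Available devices whose hypercube is under-explored. -/
noncomputable def underExplored (S : System D V) (h : ℕ) (K : ℕ → ℝ) (t : ℕ) (R : Record D) :
    Finset V :=
  (S.avail t).filter fun ν => (R.count (cell h (S.ctx t ν)) : ℝ) ≤ K t

/-- `A` is a decision that the online policy with parameters `h` and `K` may take in round `t`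
when its record is `R`. -/
def IsPolicyChoice (S : System D V) (h : ℕ) (K : ℕ → ℝ) (t : ℕ) (R : Record D)
    (A : Finset V) : Prop :=
  -- exploration, with at least `b^t` devices in under-explored hypercubes
  ((S.underExplored h K t R).Nonempty → S.budget t ≤ (S.underExplored h K t R).card →
    A ⊆ S.underExplored h K t R ∧ A.card = S.budget t) ∧
  -- exploration, with fewer: fill up with the best estimated of the other devices
  ((S.underExplored h K t R).Nonempty → (S.underExplored h K t R).card < S.budget t →
    ∃ F ⊆ S.avail t \ S.underExplored h K t R,
      A = S.underExplored h K t R ∪ F ∧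
      F.card = min (S.budget t - (S.underExplored h K t R).card)
        (S.avail t \ S.underExplored h K t R).card ∧
      ∀ ν ∈ F, ∀ ν' ∈ (S.avail t \ S.underExplored h K t R) \ F,
        S.deviceEstimate h t R ν' ≤ S.deviceEstimate h t R ν) ∧
  -- exploitation
  (S.underExplored h K t R = ∅ → S.IsOfflineOutput t (S.deviceEstimate h t R) A)

/-- Record after using the devices in `A` in round `t`, with indicators `q`. -/
noncomputable def update (S : System D V) (h t : ℕ) (R : Record D) (A : Finset V) (q : V → ℕ) :
    Record D :=
  ⟨fun p => R.count p + (A.filter fun ν => cell h (S.ctx t ν) = p).card,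
   fun p => R.succ p + ∑ ν ∈ A.filter (fun ν => cell h (S.ctx t ν) = p), q ν⟩

/-- A selection rule resolves the free choices of the policy (random picks and ties) by means of
a seed `ξ`.  It is a rule of the online policy with parameters `h` and `K` up to the horizon `T`
when it takes only decisions allowed by the policy (and depends measurably on the seed). -/
structure IsOnlineRule {Ξ : Type*} [MeasurableSpace Ξ] (S : System D V) (T h : ℕ) (K : ℕ → ℝ)
    (rule : Ξ → ℕ → Record D → Finset V) : Prop where
  choice : ∀ ξ t R, 1 ≤ t → t ≤ T → S.IsPolicyChoice h K t R (rule ξ t R)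
  measurable : ∀ t R A, MeasurableSet {ξ | rule ξ t R = A}

/-- The record after the rounds `1, …, n`, when the policy runs with the rule `rule`, the seed `ξ`
and the indicators `q t ν`. -/
noncomputable def record {Ξ : Type*} (S : System D V) (h : ℕ)
    (rule : Ξ → ℕ → Record D → Finset V) (ξ : Ξ) (q : ℕ → V → ℕ) : ℕ → Record D
  | 0 => Record.empty D
  | n + 1 => S.update h (n + 1) (S.record h rule ξ q n)
      (rule ξ (n + 1) (S.record h rule ξ q n)) (q (n + 1))

/-- The decision `A^t` of the running policy in round `t ≥ 1`. -/
noncomputable def decision {Ξ : Type*} (S : System D V) (h : ℕ)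
    (rule : Ξ → ℕ → Record D → Finset V) (ξ : Ξ) (q : ℕ → V → ℕ) (t : ℕ) : Finset V :=
  rule ξ t (S.record h rule ξ q (t - 1))

/-- The regret up to the horizon `T` of the policy that runs with parameter `h` and rule `rule`,
against the decisions `best t`. -/
noncomputable def regret {Ω Ξ : Type*} [MeasurableSpace Ω] (S : System D V) (P : Measure Ω)
    (c : ℕ → V → Ω → ℝ) (U : Ω → Ξ) (best : ℕ → Finset V) (T h : ℕ)
    (rule : Ξ → ℕ → Record D → Finset V) : ℝ :=
  ∫ ω, ∑ t ∈ Finset.Icc 1 T,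
    (reward (S.threshold t) S.cost (fun ν => S.success c t ν ω) (best t) -
      reward (S.threshold t) S.cost (fun ν => S.success c t ν ω)
        (S.decision h rule (U ω) (fun τ ν => S.success c τ ν ω) t)) ∂P

end System

/-- `h_T = ⌈T^{1/(3α+D)}⌉`. -/
noncomputable def partitionNumber (D : ℕ) (α : ℝ) (T : ℕ) : ℕ :=
  ⌈(T : ℝ) ^ (1 / (3 * α + D))⌉₊

/-- `K(t) = t^{2α/(3α+D)} log t`. -/
noncomputable def controlFunction (D : ℕ) (α : ℝ) (t : ℕ) : ℝ :=
  (t : ℝ) ^ (2 * α / (3 * α + D)) * Real.log t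

end CodedEdge

/-! The seed and the past returns determine the decision of a round and are independent of the
returns of that round. Hence the regret is the sum over rounds of the expected `gap`, the loss in
expected reward `u` (`regret_eq`). A round with budget zero loses nothing. Any other round is of one
of three kinds (`IsPolicyChoice.gap_le`).

Exploration: some available device lies in a hypercube with counter at most `K t`. The loss is at
most `1 + ηB`. Such a round raises the counter of some under-explored hypercube, so on every path
there are at most `h ^ D * (⌊K T⌋ + 1)` of them (`sum_explore_le`).

Exploitation with a bad estimate: the loss is again at most `1 + ηB`, and the event is rare. Since
the counter is itself random and depends on earlier returns, Hoeffding's inequality is replaced by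
an exponential supermartingale for each hypercube and Markov's inequality
(`integral_exp_exponent_le`, `measureReal_inaccurate_le`). With tolerance `ε t = t ^ (-a)`, `a = α /
(3α + D)`, one has `K t * ε t ^ 2 = log t`, so each device fails with probability at most `2 / t ^
2`, which sums to at most `π ^ 2 / 3`.

Exploitation with accurate estimates: all errors are at most `ρ + ε t`, where `ρ = L (√D / h) ^ α`
bounds the variation of `μ` on a hypercube. The offline policy is exactly optimal for its input
(`IsOfflineOutput.optimal`), and the success probability of a set changes by at most the sum of the
changes of the device probabilities (`abs_tailProb_sub_le`). So the loss is at most `2 C (ρ + ε t)`,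
with `C` a bound on the size of sets that can decode. Both `T ρ` and `∑ ε t` are of order `T ^ (1 -
a)`.

The stated constants are cruder than what this gives: `|V|` and `C = B` are enlarged at the end. -/

namespace CodedEdge

/-! ### Tail probabilities of sums of independent Bernoulli variables -/

section TailProb

variable {V : Type*} [DecidableEq V]

/-- The probability that at least `Y` of the independent events indexed by `A`, with
probabilities `p`, occur. -/
noncomputable def tailProb (Y : ℕ) (p : V → ℝ) (A : Finset V) : ℝ :=
  ∑ A' ∈ A.powerset, if Y ≤ A'.card then (∏ ν ∈ A', p ν) * ∏ ν ∈ A \ A', (1 - p ν) else 0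

lemma expectedReward_eq_tailProb (Y : ℕ) (η : ℝ) (p : V → ℝ) (A : Finset V) :
    expectedReward Y η p A = tailProb Y p A - η * A.card := by
  unfold expectedReward tailProb
  have hsub : Finset.Icc Y A.card ⊆ Finset.range (A.card + 1) := by
    intro j hj
    rw [Finset.mem_Icc] at hj
    rw [Finset.mem_range]
    omega
  rw [Finset.sum_powerset, ← Finset.sum_subset hsub]
  · congr 1
    refine Finset.sum_congr rfl fun j hj => Finset.sum_congr rfl fun A' hA' => ?_
    rw [Finset.mem_powersetCard] at hA'
    rw [if_pos (by rw [hA'.2]; exact (Finset.mem_Icc.1 hj).1)]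
  · intro j hj hj'
    refine Finset.sum_eq_zero fun A' hA' => ?_
    rw [Finset.mem_powersetCard] at hA'
    rw [Finset.mem_Icc] at hj'
    rw [Finset.mem_range] at hj
    rw [if_neg (by omega)]

lemma tailProb_empty (Y : ℕ) (p : V → ℝ) : tailProb Y p ∅ = if Y = 0 then 1 else 0 := by
  simp [tailProb]

/-- Condition on the event of `ν`. The truncated `Y - 1` is harmless at `Y = 0`, where both tails
are certain. All later facts on `tailProb` that need induction on the set rest on this recursion. -/
lemma tailProb_insert (Y : ℕ) (p : V → ℝ) {ν : V} {A : Finset V} (h : ν ∉ A) :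
    tailProb Y p (insert ν A) = p ν * tailProb (Y - 1) p A + (1 - p ν) * tailProb Y p A := by
  unfold tailProb
  rw [Finset.sum_powerset_insert h, Finset.mul_sum, Finset.mul_sum, add_comm]
  congr 1
  · refine Finset.sum_congr rfl fun B hB => ?_
    have hνB : ν ∉ B := fun hν => h (Finset.mem_powerset.1 hB hν)
    rw [Finset.card_insert_of_notMem hνB, Finset.prod_insert hνB,
      Finset.insert_sdiff_insert, Finset.sdiff_insert_of_notMem h]
    by_cases hY : Y ≤ B.card + 1
    · rw [if_pos hY, if_pos (by omega)]
      ring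
    · rw [if_neg hY, if_neg (by omega)]
      ring
  · refine Finset.sum_congr rfl fun B hB => ?_
    have hνB : ν ∉ B := fun hν => h (Finset.mem_powerset.1 hB hν)
    rw [Finset.insert_sdiff_of_notMem _ hνB,
      Finset.prod_insert (fun hν => h (Finset.mem_sdiff.1 hν).1)]
    by_cases hY : Y ≤ B.card
    · rw [if_pos hY, if_pos hY]
      ring
    · rw [if_neg hY, if_neg hY]
      ring

lemma tailProb_of_card_lt {Y : ℕ} (p : V → ℝ) {A : Finset V} (h : A.card < Y) :
    tailProb Y p A = 0 := by
  refine Finset.sum_eq_zero fun B hB => if_neg ?_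
  have := Finset.card_le_card (Finset.mem_powerset.1 hB)
  omega

lemma tailProb_nonneg (Y : ℕ) {p : V → ℝ} {A : Finset V} (hp : ∀ ν ∈ A, p ν ∈ Set.Icc 0 1) :
    0 ≤ tailProb Y p A := by
  refine Finset.sum_nonneg fun B hB => ?_
  split_ifs
  · refine mul_nonneg (Finset.prod_nonneg fun ν hν => ?_) (Finset.prod_nonneg fun ν hν => ?_)
    · exact (hp ν (Finset.mem_powerset.1 hB hν)).1
    · exact sub_nonneg.2 (hp ν (Finset.mem_sdiff.1 hν).1).2
  · exact le_rfl

lemma tailProb_zero (p : V → ℝ) (A : Finset V) : tailProb 0 p A = 1 := by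
  induction A using Finset.induction_on with
  | empty => simp [tailProb_empty]
  | insert ν A h ih => rw [tailProb_insert _ _ h, Nat.zero_sub, ih]; ring

lemma tailProb_anti {Y Y' : ℕ} (hY : Y ≤ Y') {p : V → ℝ} {A : Finset V}
    (hp : ∀ ν ∈ A, p ν ∈ Set.Icc 0 1) : tailProb Y' p A ≤ tailProb Y p A := by
  refine Finset.sum_le_sum fun B hB => ?_
  have : 0 ≤ (∏ ν ∈ B, p ν) * ∏ ν ∈ A \ B, (1 - p ν) :=
    mul_nonneg (Finset.prod_nonneg fun ν hν => (hp ν (Finset.mem_powerset.1 hB hν)).1)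
      (Finset.prod_nonneg fun ν hν => sub_nonneg.2 (hp ν (Finset.mem_sdiff.1 hν).1).2)
  split_ifs <;> first | exact le_rfl | assumption | omega

lemma tailProb_le_one (Y : ℕ) {p : V → ℝ} {A : Finset V} (hp : ∀ ν ∈ A, p ν ∈ Set.Icc 0 1) :
    tailProb Y p A ≤ 1 :=
  (tailProb_anti (Nat.zero_le Y) hp).trans_eq (tailProb_zero p A)

/-- The tail is affine in each `p ν`, with slope the difference of two tails of the remaining
events, which lies in `[0, 1]`. -/
lemma abs_tailProb_sub_le (Y : ℕ) {p p' : V → ℝ} {A : Finset V}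
    (hp : ∀ ν ∈ A, p ν ∈ Set.Icc 0 1) (hp' : ∀ ν ∈ A, p' ν ∈ Set.Icc 0 1) :
    |tailProb Y p A - tailProb Y p' A| ≤ ∑ ν ∈ A, |p ν - p' ν| := by
  induction A using Finset.induction_on generalizing Y with
  | empty => simp [tailProb_empty]
  | insert ν A h ih =>
    have hpA : ∀ ν ∈ A, p ν ∈ Set.Icc 0 1 := fun x hx => hp x (Finset.mem_insert_of_mem hx)
    have hpA' : ∀ ν ∈ A, p' ν ∈ Set.Icc 0 1 := fun x hx => hp' x (Finset.mem_insert_of_mem hx)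
    obtain ⟨h0, h1⟩ := hp' ν (Finset.mem_insert_self _ _)
    rw [tailProb_insert _ _ h, tailProb_insert _ _ h, Finset.sum_insert h]
    have e : p ν * tailProb (Y - 1) p A + (1 - p ν) * tailProb Y p A
        - (p' ν * tailProb (Y - 1) p' A + (1 - p' ν) * tailProb Y p' A)
        = (p ν - p' ν) * (tailProb (Y - 1) p A - tailProb Y p A)
          + (p' ν * (tailProb (Y - 1) p A - tailProb (Y - 1) p' A)
            + (1 - p' ν) * (tailProb Y p A - tailProb Y p' A)) := by ring
    have hd : |tailProb (Y - 1) p A - tailProb Y p A| ≤ 1 := by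
      rw [abs_of_nonneg (sub_nonneg.2 (tailProb_anti (Nat.sub_le _ _) hpA))]
      linarith [tailProb_le_one (Y - 1) hpA, tailProb_nonneg Y hpA]
    rw [e]
    refine (abs_add_le _ _).trans (add_le_add ?_ ((abs_add_le _ _).trans ?_))
    · rw [abs_mul]
      exact mul_le_of_le_one_right (abs_nonneg _) hd
    · rw [abs_mul, abs_mul, abs_of_nonneg h0, abs_of_nonneg (sub_nonneg.2 h1)]
      have a1 := mul_le_mul_of_nonneg_left (ih (Y - 1) hpA hpA') h0
      have a2 := mul_le_mul_of_nonneg_left (ih Y hpA hpA') (sub_nonneg.2 h1)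
      linarith

/-- Among the sets of the same size, a set of most likely events maximizes `tailProb`. -/
lemma tailProb_le_of_top (Y : ℕ) {p : V → ℝ} {A B : Finset V}
    (hA : ∀ ν ∈ A, p ν ∈ Set.Icc 0 1) (hB : ∀ ν ∈ B, p ν ∈ Set.Icc 0 1)
    (hcard : A.card = B.card) (htop : ∀ a ∈ A \ B, ∀ b ∈ B, p a ≤ p b) :
    tailProb Y p A ≤ tailProb Y p B := by
  induction hn : (A \ B).card generalizing A with
  | zero =>
    rw [Finset.card_eq_zero, Finset.sdiff_eq_empty_iff_subset] at hn
    rw [Finset.eq_of_subset_of_card_le hn hcard.ge]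
  | succ n ih =>
    obtain ⟨a, ha⟩ := Finset.card_pos.1 (hn.symm ▸ n.succ_pos : 0 < (A \ B).card)
    have hBA : (B \ A).card = n + 1 := by
      have h1 := Finset.card_sdiff_add_card_inter A B
      have h2 := Finset.card_sdiff_add_card_inter B A
      rw [Finset.inter_comm] at h2
      omega
    obtain ⟨b, hb⟩ := Finset.card_pos.1 (hBA.symm ▸ n.succ_pos : 0 < (B \ A).card)
    have ha' := ha
    rw [Finset.mem_sdiff] at ha hb
    have hbC : b ∉ A.erase a := fun h => hb.2 (Finset.mem_of_mem_erase h)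
    have hC : ∀ ν ∈ A.erase a, p ν ∈ Set.Icc 0 1 := fun ν hν => hA ν (Finset.mem_of_mem_erase hν)
    -- Exchange argument: swapping `a` for the at least as likely `b` cannot lower the tail, since
    -- its slope in that one probability is nonnegative.
    have step : tailProb Y p A ≤ tailProb Y p (insert b (A.erase a)) := by
      rw [← Finset.insert_erase ha.1, Finset.erase_insert (Finset.notMem_erase a A),
        tailProb_insert _ _ (Finset.notMem_erase a A), tailProb_insert _ _ hbC]
      nlinarith [htop a ha' b hb.1, tailProb_anti (Nat.sub_le Y 1) hC]
    have hsd : insert b (A.erase a) \ B = (A \ B).erase a := by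
      rw [Finset.insert_sdiff_of_mem _ hb.1, Finset.erase_sdiff_comm]
    refine step.trans (ih ?_ ?_ ?_ ?_)
    · intro ν hν
      rcases Finset.mem_insert.1 hν with rfl | hν
      · exact hB _ hb.1
      · exact hC ν hν
    · rw [Finset.card_insert_of_notMem hbC, Finset.card_erase_add_one ha.1, hcard]
    · intro x hx
      rw [hsd] at hx
      exact htop x (Finset.mem_of_mem_erase hx)
    · rw [hsd, Finset.card_erase_of_mem ha', hn]
      rfl

end TailProb

/-! ### Optimality of the offline policy, admissibility of the online one -/

section Offline

variable {V : Type*} [DecidableEq V]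

lemma foldl_argmax_spec {β : Type*} (u : β → ℝ) (f : ℕ → β) (zs : List ℕ) (b₀ : β) :
    let r := zs.foldl (fun best z => if u best < u (f z) then f z else best) b₀
    (r = b₀ ∨ ∃ z ∈ zs, r = f z) ∧ u b₀ ≤ u r ∧ ∀ z ∈ zs, u (f z) ≤ u r := by
  induction zs generalizing b₀ with
  | nil => simp
  | cons z zs ih =>
    simp only [List.foldl_cons]
    obtain ⟨h1, h2, h3⟩ := ih (if u b₀ < u (f z) then f z else b₀)
    have h4 : u b₀ ≤ u (if u b₀ < u (f z) then f z else b₀) ∧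
        u (f z) ≤ u (if u b₀ < u (f z) then f z else b₀) := by
      split_ifs with h
      · exact ⟨h.le, le_rfl⟩
      · exact ⟨le_rfl, not_lt.1 h⟩
    refine ⟨?_, h4.1.trans h2, ?_⟩
    · rcases h1 with h1 | ⟨y, hy, h1⟩
      · rw [h1]
        split_ifs
        · exact Or.inr ⟨z, by simp, rfl⟩
        · exact Or.inl rfl
      · exact Or.inr ⟨y, by simp [hy], h1⟩
    · intro y hy
      rcases List.mem_cons.1 hy with rfl | hy
      · exact h4.2.trans h2
      · exact h3 y hy

lemma linearSearch_spec (u : Finset V → ℝ) (l : List V) {s b : ℕ} (hsb : s ≤ b) :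
    (∃ z, s ≤ z ∧ z ≤ b ∧ linearSearch u l s b = (l.take z).toFinset) ∧
      ∀ z, s ≤ z → z ≤ b → u (l.take z).toFinset ≤ u (linearSearch u l s b) := by
  obtain ⟨h1, h2, h3⟩ := foldl_argmax_spec u (fun z => (l.take z).toFinset)
    (List.range' (s + 1) (b - s)) (l.take s).toFinset
  constructor
  · rcases h1 with h1 | ⟨z, hz, h1⟩
    · exact ⟨s, le_rfl, hsb, h1⟩
    · rw [List.mem_range'_1] at hz
      exact ⟨z, by omega, by omega, h1⟩
  · intro z hsz hzb
    rcases hsz.eq_or_lt with rfl | hsz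
    · exact h2
    · exact h3 z (List.mem_range'_1.2 (by omega))

/-- At fixed size the cost is constant, so the most likely devices are best. This reduces the search
over all admissible sets to prefixes of the sorted list. -/
lemma expectedReward_le_take (Y : ℕ) (η : ℝ) {p : V → ℝ} {l : List V} (hl : l.Nodup)
    (hsort : l.Pairwise fun ν ν' => p ν' ≤ p ν) (hp : ∀ ν ∈ l, p ν ∈ Set.Icc 0 1)
    {A : Finset V} (hA : A ⊆ l.toFinset) :
    expectedReward Y η p A ≤ expectedReward Y η p (l.take A.card).toFinset := by
  have hlen : A.card ≤ l.length := by
    rw [← List.toFinset_card_of_nodup hl]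
    exact Finset.card_le_card hA
  have hcard : (l.take A.card).toFinset.card = A.card := by
    rw [List.toFinset_card_of_nodup ((List.take_sublist _ _).nodup hl), List.length_take]
    exact min_eq_left hlen
  rw [expectedReward_eq_tailProb, expectedReward_eq_tailProb, hcard]
  refine sub_le_sub_right (tailProb_le_of_top Y (fun ν hν => hp ν (List.mem_toFinset.1 (hA hν)))
    (fun ν hν => hp ν (List.mem_of_mem_take (List.mem_toFinset.1 hν))) hcard.symm ?_) _
  intro a ha b hb
  rw [Finset.mem_sdiff, List.mem_toFinset] at ha
  have hal := List.mem_toFinset.1 (hA ha.1)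
  rw [← List.take_append_drop A.card l] at hsort hal
  exact (List.pairwise_append.1 hsort).2.2 b (List.mem_toFinset.1 hb) a
    ((List.mem_append.1 hal).resolve_left ha.2)

variable {D : ℕ}

lemma System.IsOfflineOutput.admissible {S : System D V} {t : ℕ} {p : V → ℝ} {A : Finset V}
    (h : S.IsOfflineOutput t p A) : S.Admissible t A := by
  obtain ⟨l, hl, hlt, -, rfl⟩ := h
  obtain ⟨⟨z, hsz, hzb, hz⟩, -⟩ := linearSearch_spec
    (expectedReward (S.threshold t) S.cost p) l (S.minSize_le t).1
  have hlen : l.length = (S.avail t).card := by rw [← hlt, List.toFinset_card_of_nodup hl]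
  rw [hz]
  refine ⟨?_, ?_, ?_⟩
  · rw [← hlt]
    intro x hx
    exact List.mem_toFinset.2 (List.mem_of_mem_take (List.mem_toFinset.1 hx))
  all_goals rw [List.toFinset_card_of_nodup ((List.take_sublist _ _).nodup hl), List.length_take]
  · exact le_min hsz (hlen ▸ (S.minSize_le t).2)
  · exact (min_le_left _ _).trans hzb

lemma System.IsOfflineOutput.optimal {S : System D V} {t : ℕ} {p : V → ℝ} {A : Finset V}
    (h : S.IsOfflineOutput t p A) (hp : ∀ ν ∈ S.avail t, p ν ∈ Set.Icc 0 1) {A' : Finset V}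
    (hA' : S.Admissible t A') :
    expectedReward (S.threshold t) S.cost p A' ≤ expectedReward (S.threshold t) S.cost p A := by
  obtain ⟨l, hl, hlt, hsort, rfl⟩ := h
  refine (expectedReward_le_take _ _ hl hsort (fun ν hν => hp ν ?_) (hlt ▸ hA'.1)).trans
    ((linearSearch_spec _ l (S.minSize_le t).1).2 _ hA'.2.1 hA'.2.2)
  rw [← hlt]
  exact List.mem_toFinset.2 hν

/-- Exploration either exhausts the budget or uses every available device; `minSize` is at most both
numbers. -/
lemma System.IsPolicyChoice.admissible {S : System D V} {h : ℕ} {K : ℕ → ℝ} {t : ℕ}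
    {R : Record D} {A : Finset V} (hA : S.IsPolicyChoice h K t R A) : S.Admissible t A := by
  obtain ⟨h1, h2, h3⟩ := hA
  have hsub : S.underExplored h K t R ⊆ S.avail t := Finset.filter_subset _ _
  have hs := S.minSize_le t
  by_cases hU : (S.underExplored h K t R).Nonempty
  · by_cases hb : S.budget t ≤ (S.underExplored h K t R).card
    · obtain ⟨hAU, hc⟩ := h1 hU hb
      exact ⟨hAU.trans hsub, hc ▸ hs.1, hc.le⟩
    · obtain ⟨F, hF, rfl, hc, -⟩ := h2 hU (not_le.1 hb)
      have hdis : Disjoint (S.underExplored h K t R) F :=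
        Finset.disjoint_of_subset_right hF Finset.disjoint_sdiff
      have hcs := Finset.card_sdiff_add_card_eq_card hsub
      refine ⟨Finset.union_subset hsub (hF.trans Finset.sdiff_subset), ?_, ?_⟩ <;>
        rw [Finset.card_union_of_disjoint hdis] <;> omega
  · exact (h3 (Finset.not_nonempty_iff_eq_empty.1 hU)).admissible

end Offline

/-! ### Finitely valued random objects -/

section FiniteValued

variable {Ω β γ : Type*}

/-- A function with finitely many values and `m`-measurable fibers. -/
structure FiniteValued (m : MeasurableSpace Ω) (f : Ω → β) : Prop where
  finite_range : (Set.range f).Finite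
  measurableSet_fiber : ∀ b, MeasurableSet[m] (f ⁻¹' {b})

namespace FiniteValued

variable {m mΩ : MeasurableSpace Ω} {f : Ω → β}

lemma const (m : MeasurableSpace Ω) (b : β) : FiniteValued m fun _ : Ω => b :=
  ⟨Set.finite_range_const, fun _ => MeasurableSet.const _⟩

lemma mono (hf : FiniteValued m f) (h : m ≤ mΩ) : FiniteValued mΩ f :=
  ⟨hf.finite_range, fun b => h _ (hf.measurableSet_fiber b)⟩

/-- Covers a decision that depends on the seed directly and also through the random record: the
fibers split along the finitely many records. -/
lemma bind (hf : FiniteValued m f) {g : β → Ω → γ} (hg : ∀ b, FiniteValued m (g b)) :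
    FiniteValued m fun ω => g (f ω) ω := by
  constructor
  · refine (hf.finite_range.biUnion fun b _ => (hg b).finite_range).subset ?_
    rintro _ ⟨ω, rfl⟩
    exact Set.mem_biUnion ⟨ω, rfl⟩ ⟨ω, rfl⟩
  · intro c
    have : (fun ω => g (f ω) ω) ⁻¹' {c} = ⋃ b ∈ Set.range f, f ⁻¹' {b} ∩ g b ⁻¹' {c} := by
      ext ω
      simp only [Set.mem_preimage, Set.mem_singleton_iff, Set.mem_iUnion, Set.mem_inter_iff,
        exists_prop]
      exact ⟨fun h => ⟨f ω, ⟨ω, rfl⟩, rfl, h⟩, fun ⟨b, _, hb, h⟩ => by rwa [hb]⟩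
    rw [this]
    exact MeasurableSet.biUnion hf.finite_range.countable fun b _ =>
      (hf.measurableSet_fiber b).inter ((hg b).measurableSet_fiber c)

lemma comp (hf : FiniteValued m f) (φ : β → γ) : FiniteValued m fun ω => φ (f ω) :=
  hf.bind fun b => const m (φ b)

lemma prodMk (hf : FiniteValued m f) {g : Ω → γ} (hg : FiniteValued m g) :
    FiniteValued m fun ω => (f ω, g ω) :=
  hf.bind fun b => hg.comp fun c => (b, c)

lemma measurableSet_preimage (hf : FiniteValued m f) (s : Set β) : MeasurableSet[m] (f ⁻¹' s) := by
  have := (hf.comp (fun b => b ∈ s)).measurableSet_fiber True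
  convert this using 1
  ext ω
  simp

variable {P : Measure Ω} [IsFiniteMeasure P]

lemma comp_eq_sum (φ : β → ℝ) {s : Finset β} (hs : Set.range f ⊆ s) (ω : Ω) :
    φ (f ω) = ∑ b ∈ s, (f ⁻¹' {b}).indicator (fun _ => φ b) ω := by
  classical
  rw [Finset.sum_eq_single_of_mem (f ω) (hs ⟨ω, rfl⟩)]
  · simp
  · intro b _ hb
    exact Set.indicator_of_notMem (fun h => hb (by simpa using h.symm)) _

lemma integrable (hf : FiniteValued mΩ f) (φ : β → ℝ) : Integrable (fun ω => φ (f ω)) P := by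
  simp_rw [comp_eq_sum φ hf.finite_range.coe_toFinset.symm.subset]
  exact integrable_finsetSum _ fun b _ =>
    (integrable_const _).indicator (hf.measurableSet_fiber b)

lemma integral_eq_sum (hf : FiniteValued mΩ f) (φ : β → ℝ) {s : Finset β}
    (hs : Set.range f ⊆ s) : ∫ ω, φ (f ω) ∂P = ∑ b ∈ s, P.real (f ⁻¹' {b}) * φ b := by
  simp_rw [comp_eq_sum φ hs]
  rw [integral_finsetSum _ fun b _ =>
    (integrable_const _).indicator (hf.measurableSet_fiber b)]
  refine Finset.sum_congr rfl fun b _ => ?_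
  rw [integral_indicator_const _ (hf.measurableSet_fiber b), smul_eq_mul]

/-- Freezing the argument `f ω` while integrating over `g`. With finitely many values this only
needs the fiber probabilities to factor. -/
lemma integral_of_indep (hm : m ≤ mΩ) (hf : FiniteValued m f) {g : Ω → γ}
    (hg : FiniteValued mΩ g) (hind : ∀ s, MeasurableSet[m] s → ∀ c,
      P.real (s ∩ g ⁻¹' {c}) = P.real s * P.real (g ⁻¹' {c})) (F : β → γ → ℝ) :
    ∫ ω, F (f ω) (g ω) ∂P = ∫ ω, ∫ ω', F (f ω) (g ω') ∂P ∂P := by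
  classical
  have hs := hf.finite_range.coe_toFinset.symm.subset
  have ht := hg.finite_range.coe_toFinset.symm.subset
  rw [(hf.mono hm).integral_eq_sum (fun b => ∫ ω', F b (g ω') ∂P) hs,
    ((hf.mono hm).prodMk hg).integral_eq_sum (fun z => F z.1 z.2)
      (s := hf.finite_range.toFinset ×ˢ hg.finite_range.toFinset)
      (by rintro _ ⟨ω, rfl⟩; simp), Finset.sum_product]
  refine Finset.sum_congr rfl fun b _ => ?_
  rw [hg.integral_eq_sum (F b) ht, Finset.mul_sum]
  refine Finset.sum_congr rfl fun c _ => ?_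
  rw [← mul_assoc, ← hind _ (hf.measurableSet_fiber b)]
  congr 2
  ext ω
  simp

end FiniteValued

end FiniteValued

/-! ### Independent Bernoulli variables -/

section Bernoulli

variable {Ω V : Type*} [MeasurableSpace Ω] {P : Measure Ω} [IsProbabilityMeasure P]
  {q : V → Ω → ℕ}

/-- The sum over `A` is independent of `q ν`, so splitting on `q ν` reproduces the recursion
`tailProb_insert`. -/
lemma measureReal_threshold_le_sum [DecidableEq V] (hq : ∀ ν, Measurable (q ν))
    (hind : iIndepFun q P) (h01 : ∀ ν ω, q ν ω = 0 ∨ q ν ω = 1) (Y : ℕ) {p : V → ℝ} {A : Finset V}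
    (hp : ∀ ν ∈ A, P.real {ω | q ν ω = 1} = p ν) :
    P.real {ω | Y ≤ ∑ ν ∈ A, q ν ω} = tailProb Y p A := by
  induction A using Finset.induction_on generalizing Y with
  | empty =>
    rw [tailProb_empty]
    by_cases hY : Y = 0 <;> simp [hY]
  | insert ν A h ih =>
    have hpA : ∀ x ∈ A, P.real {ω | q x ω = 1} = p x :=
      fun x hx => hp x (Finset.mem_insert_of_mem hx)
    have hSm : Measurable fun ω => ∑ x ∈ A, q x ω :=
      Finset.measurable_sum _ fun x _ => hq x
    have hi : IndepFun (fun ω => ∑ x ∈ A, q x ω) (q ν) P := by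
      have := hind.indepFun_finsetSum_of_notMem hq h
      convert this using 1
      ext ω
      simp
    have hmul : ∀ Z k : ℕ, P.real ({ω | Z ≤ ∑ x ∈ A, q x ω} ∩ {ω | q ν ω = k})
        = P.real {ω | Z ≤ ∑ x ∈ A, q x ω} * P.real {ω | q ν ω = k} := by
      intro Z k
      have := hi.measure_inter_preimage_eq_mul (Set.Ici Z) {k} measurableSet_Ici
        (measurableSet_singleton k)
      simp only [measureReal_def, ← ENNReal.toReal_mul]
      exact congrArg ENNReal.toReal this
    have h1 := hp ν (Finset.mem_insert_self _ _)
    have hmeas1 : MeasurableSet {ω | q ν ω = 1} := hq ν (measurableSet_singleton 1)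
    have hcompl : {ω | q ν ω = 1}ᶜ = {ω | q ν ω = 0} := by
      ext ω
      rcases h01 ν ω with h | h <;> simp [h]
    have h0 : P.real {ω | q ν ω = 0} = 1 - p ν := by
      rw [← hcompl, probReal_compl_eq_one_sub hmeas1, h1]
    have e1 : {ω | Y ≤ ∑ x ∈ insert ν A, q x ω} ∩ {ω | q ν ω = 1}
        = {ω | Y - 1 ≤ ∑ x ∈ A, q x ω} ∩ {ω | q ν ω = 1} := by
      ext ω
      simp only [Finset.sum_insert h, Set.mem_inter_iff, Set.mem_ofPred_eq]
      refine and_congr_left fun hω => ?_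
      omega
    have e0 : {ω | Y ≤ ∑ x ∈ insert ν A, q x ω} ∩ {ω | q ν ω = 0}
        = {ω | Y ≤ ∑ x ∈ A, q x ω} ∩ {ω | q ν ω = 0} := by
      ext ω
      simp only [Finset.sum_insert h, Set.mem_inter_iff, Set.mem_ofPred_eq]
      refine and_congr_left fun hω => ?_
      omega
    rw [tailProb_insert _ _ h, ← measureReal_inter_add_sdiff hmeas1 (s := {ω | Y ≤ ∑ x ∈ insert ν A, q x ω}),
      Set.sdiff_eq, hcompl, e1, e0, hmul, hmul, ih _ hpA, ih _ hpA, h0, h1]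
    ring

/-- Hoeffding's lemma for a Bernoulli variable, not centered exactly. -/
lemma integral_exp_bernoulli_le {X : Ω → ℕ} (hX : Measurable X) (h01 : ∀ ω, X ω = 0 ∨ X ω = 1)
    {l m : ℝ} (hm : l * (P.real {ω | X ω = 1} - m) ≤ 0) :
    ∫ ω, Real.exp (l * (X ω - m) - l ^ 2 / 8) ∂P ≤ 1 := by
  have hXr : Measurable fun ω => (X ω : ℝ) := measurable_from_top.comp hX
  have hb : ∀ᵐ ω ∂P, (X ω : ℝ) ∈ Set.Icc (0 : ℝ) 1 :=
    ae_of_all _ fun ω => by rcases h01 ω with h | h <;> simp [h]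
  have hE : ∫ ω, (X ω : ℝ) ∂P = P.real {ω | X ω = 1} := by
    have hmeas : MeasurableSet {ω | X ω = 1} := hX (measurableSet_singleton 1)
    rw [← integral_indicator_one hmeas]
    refine integral_congr_ae (ae_of_all _ fun ω => ?_)
    rcases h01 ω with h | h <;> simp [h]
  have hmgf := (hasSubgaussianMGF_of_mem_Icc hXr.aemeasurable hb).mgf_le l
  rw [mgf, hE] at hmgf
  have hsplit : ∀ ω, Real.exp (l * (X ω - m) - l ^ 2 / 8)
      = Real.exp (l * (P.real {ω | X ω = 1} - m) - l ^ 2 / 8)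
        * Real.exp (l * (X ω - P.real {ω | X ω = 1})) := by
    intro ω
    rw [← Real.exp_add]
    congr 1
    ring
  simp_rw [hsplit]
  rw [integral_const_mul]
  refine (mul_le_mul_of_nonneg_left hmgf (Real.exp_pos _).le).trans ?_
  rw [← Real.exp_add]
  refine Real.exp_le_one_iff.2 ?_
  norm_num
  linarith

lemma integral_prod_exp_bernoulli_le [Fintype V] [DecidableEq V] (hq : ∀ ν, Measurable (q ν))
    (hind : iIndepFun q P) (h01 : ∀ ν ω, q ν ω = 0 ∨ q ν ω = 1) {A : Finset V} {l m : ℝ}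
    (hm : ∀ ν ∈ A, l * (P.real {ω | q ν ω = 1} - m) ≤ 0) :
    ∫ ω, ∏ ν ∈ A, Real.exp (l * (q ν ω - m) - l ^ 2 / 8) ∂P ≤ 1 := by
  -- The factor `1` off `A` turns this into a product over all devices, to which independence of the
  -- whole family applies.
  let g : V → ℕ → ℝ := fun ν k => if ν ∈ A then Real.exp (l * (k - m) - l ^ 2 / 8) else 1
  have e : ∀ ω, ∏ ν ∈ A, Real.exp (l * (q ν ω - m) - l ^ 2 / 8) = ∏ ν, g ν (q ν ω) := by
    intro ω
    rw [Finset.prod_ite_mem, Finset.univ_inter]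
  simp_rw [e]
  rw [hind.integral_fun_prod_comp (fun ν => (hq ν).aemeasurable)
    fun ν => measurable_from_top.aestronglyMeasurable]
  refine Finset.prod_le_one (fun ν _ => integral_nonneg fun ω => ?_) fun ν _ => ?_
  · simp only [g]
    split_ifs
    · exact (Real.exp_pos _).le
    · exact zero_le_one
  · by_cases hν : ν ∈ A
    · simp only [g, hν, if_true]
      exact integral_exp_bernoulli_le (hq ν) (h01 ν) (hm ν hν)
    · simp [g, hν]

end Bernoulli

/-! ### Regrouping independence -/

section Indep

variable {Ω : Type*} [MeasurableSpace Ω] {P : Measure Ω} [IsProbabilityMeasure P]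

/-- The law of the triple is the product of the three laws, whichever way it is bracketed. Used with
`X` the seed, `Y` the past returns and `Z` the returns of the next round. -/
lemma IndepFun.prodMk_of_prodMk {α β γ : Type*} [MeasurableSpace α] [MeasurableSpace β]
    [MeasurableSpace γ] {X : Ω → α} {Y : Ω → β} {Z : Ω → γ} (hX : Measurable X)
    (hY : Measurable Y) (hZ : Measurable Z) (h : IndepFun X (fun ω => (Y ω, Z ω)) P)
    (hYZ : IndepFun Y Z P) : IndepFun (fun ω => (X ω, Y ω)) Z P := by
  have hXY : IndepFun X Y P := h.comp measurable_id measurable_fst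
  have := Measure.isProbabilityMeasure_map (μ := P) hX.aemeasurable
  have := Measure.isProbabilityMeasure_map (μ := P) hY.aemeasurable
  have := Measure.isProbabilityMeasure_map (μ := P) hZ.aemeasurable
  rw [indepFun_iff_map_prod_eq_prod_map_map (hX.prodMk hY).aemeasurable hZ.aemeasurable,
    (indepFun_iff_map_prod_eq_prod_map_map hX.aemeasurable hY.aemeasurable).1 hXY]
  have h3 := (indepFun_iff_map_prod_eq_prod_map_map hX.aemeasurable
    (hY.prodMk hZ).aemeasurable).1 h
  rw [(indepFun_iff_map_prod_eq_prod_map_map hY.aemeasurable hZ.aemeasurable).1 hYZ,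
    ← Measure.prodAssoc_prod] at h3
  have h4 := congrArg (Measure.map MeasurableEquiv.prodAssoc.symm) h3
  rw [MeasurableEquiv.map_symm_map, Measure.map_map MeasurableEquiv.prodAssoc.symm.measurable
    (hX.prodMk (hY.prodMk hZ))] at h4
  exact h4

end Indep

/-! ### Hypercubes and the Hölder condition -/

section Geometry

variable {D : ℕ}

lemma cell_apply_bounds {h : ℕ} (hh : 1 ≤ h) {x : EuclideanSpace ℝ (Fin D)}
    (hx : x ∈ contextSpace D) (i : Fin D) :
    (cell h x i : ℝ) ≤ h * x i ∧ (h : ℝ) * x i ≤ cell h x i + 1 := by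
  have h0 : (0 : ℝ) ≤ h * x i := mul_nonneg (Nat.cast_nonneg _) (hx i).1
  have h1 : (h : ℝ) * x i ≤ h := mul_le_of_le_one_right (Nat.cast_nonneg _) (hx i).2
  have hc : cell h x i = min ⌊(h : ℝ) * x i⌋₊ (h - 1) := rfl
  rcases le_total ⌊(h : ℝ) * x i⌋₊ (h - 1) with hle | hle
  · rw [hc, min_eq_left hle]
    exact ⟨Nat.floor_le h0, (Nat.lt_floor_add_one _).le⟩
  -- In the last, closed interval the upper bound comes from `x i ≤ 1` and not from the floor.
  · rw [hc, min_eq_right hle]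
    refine ⟨(Nat.cast_le.2 hle).trans (Nat.floor_le h0), ?_⟩
    rw [Nat.cast_sub hh]
    simpa using h1

lemma norm_sub_le_of_cell_eq {h : ℕ} (hh : 1 ≤ h) {x y : EuclideanSpace ℝ (Fin D)}
    (hx : x ∈ contextSpace D) (hy : y ∈ contextSpace D) (hxy : cell h x = cell h y) :
    ‖x - y‖ ≤ √D / h := by
  have hh0 : (0 : ℝ) < h := by exact_mod_cast hh
  have key : ∀ i, ‖(x - y) i‖ ^ 2 ≤ (1 / h : ℝ) ^ 2 := by
    intro i
    refine pow_le_pow_left₀ (norm_nonneg _) ?_ 2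
    obtain ⟨a1, a2⟩ := cell_apply_bounds hh hx i
    obtain ⟨b1, b2⟩ := cell_apply_bounds hh hy i
    rw [← hxy] at b1 b2
    rw [PiLp.sub_apply, Real.norm_eq_abs, le_div_iff₀ hh0, ← abs_of_pos hh0, ← abs_mul, abs_le]
    constructor <;> linarith
  rw [EuclideanSpace.norm_eq]
  calc √(∑ i, ‖(x - y) i‖ ^ 2) ≤ √(∑ _i : Fin D, (1 / h : ℝ) ^ 2) :=
        Real.sqrt_le_sqrt (Finset.sum_le_sum fun i _ => key i)
    _ = √D / h := by
        rw [Finset.sum_const, Finset.card_univ, Fintype.card_fin, nsmul_eq_mul,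
          Real.sqrt_mul (Nat.cast_nonneg _), Real.sqrt_sq (by positivity)]
        ring

lemma HolderCondition.abs_sub_le_of_cell_eq {f : EuclideanSpace ℝ (Fin D) → ℝ} {L α : ℝ}
    (hL : 0 ≤ L) (hα : 0 ≤ α) (hf : HolderCondition f L α) {h : ℕ} (hh : 1 ≤ h)
    {x y : EuclideanSpace ℝ (Fin D)} (hx : x ∈ contextSpace D) (hy : y ∈ contextSpace D)
    (hxy : cell h x = cell h y) : |f x - f y| ≤ L * (√D / h) ^ α :=
  (hf x hx y hy).trans (mul_le_mul_of_nonneg_left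
    (Real.rpow_le_rpow (norm_nonneg _) (norm_sub_le_of_cell_eq hh hx hy hxy) hα) hL)

lemma cell_mem_piFinset {h : ℕ} (hh : 1 ≤ h) (x : EuclideanSpace ℝ (Fin D)) :
    cell h x ∈ Fintype.piFinset fun _ : Fin D => Finset.range h := by
  rw [Fintype.mem_piFinset]
  intro i
  rw [Finset.mem_range]
  exact (min_le_right _ _).trans_lt (by omega)

end Geometry

/-! ### Pathwise bounds: counting explorations, loss in a round -/

namespace System

variable {D : ℕ} {V : Type*} [DecidableEq V] {S : System D V}

omit [DecidableEq V] in
lemma deviceProb_mem (S : System D V) (t : ℕ) {ν : V} (hν : ν ∈ S.avail t) :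
    S.deviceProb t ν ∈ Set.Icc 0 1 :=
  S.succProb_mem _ (S.ctx_mem t ν hν)

section Run

variable {Ξ : Type*} {h : ℕ} {rule : Ξ → ℕ → Record D → Finset V} {ξ : Ξ} {q : ℕ → V → ℕ}

omit [DecidableEq V] in
lemma record_succ_le_count (hq : ∀ t ν, q t ν ≤ 1) (n : ℕ) (p : Fin D → ℕ) :
    (S.record h rule ξ q n).succ p ≤ (S.record h rule ξ q n).count p := by
  induction n with
  | zero => exact le_rfl
  | succ n ih =>
    refine add_le_add ih ?_
    rw [Finset.card_eq_sum_ones]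
    exact Finset.sum_le_sum fun ν _ => hq _ ν

omit [DecidableEq V] in
lemma deviceEstimate_record_mem (hq : ∀ t ν, q t ν ≤ 1) (n t : ℕ) (ν : V) :
    S.deviceEstimate h t (S.record h rule ξ q n) ν ∈ Set.Icc 0 1 := by
  refine ⟨div_nonneg (Nat.cast_nonneg _) (Nat.cast_nonneg _), div_le_one_of_le₀ ?_
    (Nat.cast_nonneg _)⟩
  exact_mod_cast record_succ_le_count hq n _

/-- The rounds in which the policy explores with a positive budget are few. -/
lemma sum_explore_le {T : ℕ} {K : ℕ → ℝ} {k : ℕ} (hh : 1 ≤ h)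
    (hrule : ∀ t R, 1 ≤ t → t ≤ T → S.IsPolicyChoice h K t R (rule ξ t R))
    (hK : ∀ t, 1 ≤ t → t ≤ T → K t < k) :
    ∑ t ∈ Finset.Icc 1 T,
      (if (S.underExplored h K t (S.record h rule ξ q (t - 1))).Nonempty ∧ 1 ≤ S.budget t
        then 1 else 0) ≤ h ^ D * k := by
  set cells := Fintype.piFinset fun _ : Fin D => Finset.range h
  -- The potential `∑ p, min (count p) k` never exceeds `h ^ D * k` and grows by at least one in
  -- every counted round. Rounds with budget zero are not counted, since they select no device and
  -- move no counter.
  have hbound : ∀ n ≤ T, ∑ t ∈ Finset.Icc 1 n,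
      (if (S.underExplored h K t (S.record h rule ξ q (t - 1))).Nonempty ∧ 1 ≤ S.budget t
        then 1 else 0) ≤ ∑ p ∈ cells, min ((S.record h rule ξ q n).count p) k := by
    intro n hn
    induction n with
    | zero => simp
    | succ n ih =>
      rw [Finset.sum_Icc_succ_top (by omega), Nat.add_sub_cancel]
      have hmono : ∀ p ∈ cells, min ((S.record h rule ξ q n).count p) k
          ≤ min ((S.record h rule ξ q (n + 1)).count p) k :=
        fun p _ => min_le_min_right _ (Nat.le_add_right _ _)
      split_ifs with hex
      · refine (Nat.succ_le_succ (ih (by omega))).trans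
          (Nat.succ_le_of_lt (Finset.sum_lt_sum hmono ?_))
        set R := S.record h rule ξ q n
        obtain ⟨c1, c2, -⟩ := hrule (n + 1) R (by omega) hn
        obtain ⟨ν, hνA, hνU⟩ : ∃ ν ∈ rule ξ (n + 1) R, ν ∈ S.underExplored h K (n + 1) R := by
          by_cases hb : S.budget (n + 1) ≤ (S.underExplored h K (n + 1) R).card
          · obtain ⟨d1, d2⟩ := c1 hex.1 hb
            obtain ⟨ν, hν⟩ := Finset.card_pos.1 (by omega : 0 < (rule ξ (n + 1) R).card)
            exact ⟨ν, hν, d1 hν⟩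
          · obtain ⟨F, -, hF, -⟩ := c2 hex.1 (not_le.1 hb)
            obtain ⟨ν, hν⟩ := hex.1
            exact ⟨ν, hF ▸ Finset.mem_union_left _ hν, hν⟩
        refine ⟨cell h (S.ctx (n + 1) ν), cell_mem_piFinset hh _, ?_⟩
        have hcount : R.count (cell h (S.ctx (n + 1) ν)) < k := by
          have := (Finset.mem_filter.1 hνU).2.trans_lt (hK (n + 1) (by omega) hn)
          exact_mod_cast this
        have hpos : 0 < ((rule ξ (n + 1) R).filter
            fun x => cell h (S.ctx (n + 1) x) = cell h (S.ctx (n + 1) ν)).card :=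
          Finset.card_pos.2 ⟨ν, Finset.mem_filter.2 ⟨hνA, rfl⟩⟩
        have hstep : (S.record h rule ξ q (n + 1)).count (cell h (S.ctx (n + 1) ν))
            = R.count (cell h (S.ctx (n + 1) ν)) + ((rule ξ (n + 1) R).filter
              fun x => cell h (S.ctx (n + 1) x) = cell h (S.ctx (n + 1) ν)).card := rfl
        rw [hstep]
        omega
      · exact (ih (by omega)).trans (Finset.sum_le_sum hmono)
  refine (hbound T le_rfl).trans ((Finset.sum_le_card_nsmul _ _ k fun p _ => min_le_right _ _).trans
    (le_of_eq ?_))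
  simp [cells]

end Run

/-- If all estimates are accurate, exploitation is nearly optimal. -/
lemma IsOfflineOutput.gap_le {t : ℕ} {p : V → ℝ} {A A' : Finset V}
    (hA : S.IsOfflineOutput t p A) (hA' : S.Admissible t A') {δ C : ℝ} (hδ : 0 ≤ δ) (hC : 0 ≤ C)
    (hp : ∀ ν ∈ S.avail t, p ν ∈ Set.Icc 0 1)
    (hacc : ∀ ν ∈ S.avail t, |p ν - S.deviceProb t ν| ≤ δ)
    (hcard : ∀ B, S.Admissible t B → S.threshold t ≤ B.card → (B.card : ℝ) ≤ C) :
    expectedReward (S.threshold t) S.cost (S.deviceProb t) A'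
      - expectedReward (S.threshold t) S.cost (S.deviceProb t) A ≤ 2 * C * δ := by
  have key : ∀ B, S.Admissible t B → |expectedReward (S.threshold t) S.cost p B
      - expectedReward (S.threshold t) S.cost (S.deviceProb t) B| ≤ C * δ := by
    intro B hB
    rw [expectedReward_eq_tailProb, expectedReward_eq_tailProb, sub_sub_sub_cancel_right]
    rcases lt_or_ge B.card (S.threshold t) with hlt | hge
    · rw [tailProb_of_card_lt _ hlt, tailProb_of_card_lt _ hlt, sub_zero, abs_zero]
      positivity
    · refine (abs_tailProb_sub_le _ (fun ν hν => hp ν (hB.1 hν))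
        fun ν hν => S.deviceProb_mem t (hB.1 hν)).trans ?_
      refine (Finset.sum_le_card_nsmul _ _ δ fun ν hν => hacc ν (hB.1 hν)).trans ?_
      rw [nsmul_eq_mul]
      exact mul_le_mul_of_nonneg_right (hcard B hB hge) hδ
  have h1 := hA.optimal hp hA'
  have h2 := abs_le.1 (key A hA.admissible)
  have h3 := abs_le.1 (key A' hA')
  linarith

lemma gap_le_of_card_le (S : System D V) {t : ℕ} {A A' : Finset V} (hA : A ⊆ S.avail t)
    (hA' : A' ⊆ S.avail t) {N : ℝ} (hN : (A.card : ℝ) ≤ N) :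
    expectedReward (S.threshold t) S.cost (S.deviceProb t) A'
      - expectedReward (S.threshold t) S.cost (S.deviceProb t) A ≤ 1 + S.cost * N := by
  rw [expectedReward_eq_tailProb, expectedReward_eq_tailProb]
  have h1 := tailProb_le_one (S.threshold t) fun ν hν => S.deviceProb_mem t (hA' hν)
  have h2 := tailProb_nonneg (S.threshold t) fun ν hν => S.deviceProb_mem t (hA hν)
  have h3 := mul_le_mul_of_nonneg_left hN S.cost_nonneg
  have h4 := mul_nonneg S.cost_nonneg (Nat.cast_nonneg (α := ℝ) A'.card)
  linarith

end System

/-- Exponent of the exponential supermartingale of a hypercube. -/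
noncomputable def Record.exponent {D : ℕ} (l m : ℝ) (p : Fin D → ℕ) (R : Record D) : ℝ :=
  l * (R.succ p - R.count p * m) - R.count p * (l ^ 2 / 8)

/-! ### The stochastic model and concentration of the estimates -/

namespace System

variable {D : ℕ} {V : Type*} {S : System D V} {Ω : Type*} {c : ℕ → V → Ω → ℝ}

lemma success_eq_zero_or_one (S : System D V) (c : ℕ → V → Ω → ℝ) (t : ℕ) (ν : V) (ω : Ω) :
    S.success c t ν ω = 0 ∨ S.success c t ν ω = 1 := by
  unfold success
  split_ifs <;> simp

lemma success_le_one (S : System D V) (c : ℕ → V → Ω → ℝ) (t : ℕ) (ν : V) (ω : Ω) :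
    S.success c t ν ω ≤ 1 := by
  rcases S.success_eq_zero_or_one c t ν ω with h | h <;> omega

lemma finite_range_success [Finite V] (S : System D V) (c : ℕ → V → Ω → ℝ) (t : ℕ) :
    (Set.range fun ω ν => S.success c t ν ω).Finite := by
  refine (Set.Finite.pi' (t := fun _ : V => Set.Iic 1) fun _ => Set.finite_Iic 1).subset ?_
  rintro _ ⟨ω, rfl⟩ ν
  exact S.success_le_one c t ν ω

/-- The events determined by the seed and by the returns up to round `N`. -/
@[reducible] noncomputable def past {Ξ : Type*} [MeasurableSpace Ξ] [Fintype V] (S : System D V) (c : ℕ → V → Ω → ℝ)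
    (U : Ω → Ξ) (N : ℕ) : MeasurableSpace Ω :=
  MeasurableSpace.comap (fun ω => (U ω,
    fun i : (Finset.range (N + 1) ×ˢ Finset.univ : Finset (ℕ × V)) =>
      S.success c i.1.1 i.1.2 ω)) inferInstance

section Measurability

variable [Fintype V] {Ξ : Type*} [MeasurableSpace Ξ] {U : Ω → Ξ}

lemma measurable_past (S : System D V) (c : ℕ → V → Ω → ℝ) (U : Ω → Ξ) (N : ℕ) :
    Measurable[S.past c U N] U :=
  (measurable_fst (α := Ξ)).comp (comap_measurable _)

lemma measurable_success_past (S : System D V) (c : ℕ → V → Ω → ℝ) (U : Ω → Ξ) {n N : ℕ}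
    (hn : n ≤ N) (ν : V) : Measurable[S.past c U N] (S.success c n ν) := by
  have hmem : (n, ν) ∈ (Finset.range (N + 1) ×ˢ Finset.univ : Finset (ℕ × V)) := by
    simp only [Finset.mem_product, Finset.mem_range, Finset.mem_univ, and_true]
    omega
  have hev : Measurable fun z : Ξ × ((Finset.range (N + 1) ×ˢ Finset.univ : Finset (ℕ × V)) → ℕ) =>
      z.2 ⟨(n, ν), hmem⟩ := (measurable_pi_apply _).comp measurable_snd
  exact hev.comp (comap_measurable _)

lemma finiteValued_success {m : MeasurableSpace Ω} {t : ℕ}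
    (hm : ∀ ν, Measurable[m] (S.success c t ν)) :
    FiniteValued m fun ω ν => S.success c t ν ω :=
  ⟨S.finite_range_success c t, fun y => measurable_pi_lambda _ hm (measurableSet_singleton y)⟩

variable [DecidableEq V] {T h : ℕ} {K : ℕ → ℝ} {rule : Ξ → ℕ → Record D → Finset V}

lemma finiteValued_rule (hrule : S.IsOnlineRule T h K rule) {m : MeasurableSpace Ω}
    (hU : Measurable[m] U) (t : ℕ) {f : Ω → Record D} (hf : FiniteValued m f) :
    FiniteValued m fun ω => rule (U ω) t (f ω) :=
  hf.bind (g := fun R ω => rule (U ω) t R)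
    fun R => ⟨Set.toFinite _, fun A => hU (hrule.measurable t R A)⟩

lemma finiteValued_record (hrule : S.IsOnlineRule T h K rule) {n N : ℕ} (hn : n ≤ N) :
    FiniteValued (S.past c U N)
      fun ω => S.record h rule (U ω) (fun τ ν => S.success c τ ν ω) n := by
  induction n with
  | zero => exact FiniteValued.const _ _
  | succ n ih =>
    have hR := ih (by omega)
    have hA := finiteValued_rule hrule (S.measurable_past c U N) (n + 1) hR
    have hq := finiteValued_success fun ν => S.measurable_success_past c U hn ν
    exact ((hR.prodMk hA).prodMk hq).comp fun z => S.update h (n + 1) z.1.1 z.1.2 z.2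

end Measurability

section Model

variable [MeasurableSpace Ω] {P : Measure Ω}

lemma IsDelayModel.measurable_success (hc : S.IsDelayModel P c) (t : ℕ) (ν : V) :
    Measurable (S.success c t ν) :=
  Measurable.ite (measurableSet_le (hc.measurable t ν) measurable_const) measurable_const
    measurable_const

lemma IsDelayModel.iIndepFun_round (hc : S.IsDelayModel P c) (t : ℕ) :
    iIndepFun (S.success c t) P :=
  hc.indep.precomp (g := fun ν => (t, ν)) fun _ _ h => (Prod.mk.inj h).2

lemma IsDelayModel.prob_success (hc : S.IsDelayModel P c) {t : ℕ} (ht : 1 ≤ t) {ν : V}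
    (hν : ν ∈ S.avail t) : P.real {ω | S.success c t ν ω = 1} = S.deviceProb t ν := by
  rw [← hc.prob t ht ν hν]
  congr 1
  ext ω
  simp [success]

variable [IsProbabilityMeasure P]

lemma IsDelayModel.integral_reward [DecidableEq V] [Finite V] (hc : S.IsDelayModel P c) {t : ℕ}
    (ht : 1 ≤ t) {A : Finset V} (hA : A ⊆ S.avail t) :
    ∫ ω, reward (S.threshold t) S.cost (fun ν => S.success c t ν ω) A ∂P
      = expectedReward (S.threshold t) S.cost (S.deviceProb t) A := by
  have hm : MeasurableSet {ω | S.threshold t ≤ ∑ ν ∈ A, S.success c t ν ω} :=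
    (Finset.measurable_sum _ fun ν _ => hc.measurable_success t ν) measurableSet_Ici
  have hind : ∀ ω, reward (S.threshold t) S.cost (fun ν => S.success c t ν ω) A
      = {ω | S.threshold t ≤ ∑ ν ∈ A, S.success c t ν ω}.indicator (1 : Ω → ℝ) ω - S.cost * A.card := by
    intro ω
    simp [reward, Set.indicator_apply]
  simp_rw [hind]
  have hi : Integrable ({ω | S.threshold t ≤ ∑ ν ∈ A, S.success c t ν ω}.indicator (1 : Ω → ℝ)) P :=
    (integrable_const (1 : ℝ)).indicator hm
  rw [integral_sub hi (integrable_const _), integral_indicator_one hm, integral_const, expectedReward_eq_tailProb,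
    measureReal_threshold_le_sum (hc.measurable_success t) (hc.iIndepFun_round t)
      (S.success_eq_zero_or_one c t) _ fun ν hν => hc.prob_success ht (hA hν)]
  simp

variable [Fintype V] {Ξ : Type*} [MeasurableSpace Ξ] {U : Ω → Ξ}

omit [IsProbabilityMeasure P] in
lemma IsDelayModel.past_le (hc : S.IsDelayModel P c) (hU : Measurable U) (N : ℕ) :
    S.past c U N ≤ ‹MeasurableSpace Ω› :=
  Measurable.comap_le (hU.prodMk (measurable_pi_lambda _ fun i => hc.measurable_success i.1.1 i.1.2))

/-- Returns of different rounds are independent, and the seed is independent of all of them jointly;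
`IndepFun.prodMk_of_prodMk` combines the two. -/
lemma IsDelayModel.indep_past (hc : S.IsDelayModel P c) (hU : Measurable U)
    (hUc : IndepFun U (fun ω (i : ℕ × V) => S.success c i.1 i.2 ω) P) (N : ℕ) {s : Set Ω}
    (hs : MeasurableSet[S.past c U N] s) (y : V → ℕ) :
    P.real (s ∩ (fun ω ν => S.success c (N + 1) ν ω) ⁻¹' {y})
      = P.real s * P.real ((fun ω ν => S.success c (N + 1) ν ω) ⁻¹' {y}) := by
  classical
  set I : Finset (ℕ × V) := Finset.range (N + 1) ×ˢ Finset.univ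
  set J : Finset (ℕ × V) := {N + 1} ×ˢ Finset.univ
  have hIJ : Disjoint I J := by
    rw [Finset.disjoint_left]
    rintro ⟨n, ν⟩ hI hJ
    simp only [I, J, Finset.mem_product, Finset.mem_range, Finset.mem_singleton] at hI hJ
    omega
  have hJ : ∀ ν, (N + 1, ν) ∈ J := fun ν => by simp [J]
  have hmeas : ∀ i : ℕ × V, Measurable (S.success c i.1 i.2) :=
    fun i => hc.measurable_success i.1 i.2
  have h1 : IndepFun (fun ω (i : I) => S.success c i.1.1 i.1.2 ω)
      (fun ω ν => S.success c (N + 1) ν ω) P :=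
    (hc.indep.indepFun_finset I J hIJ hmeas).comp (φ := id)
      (ψ := fun (y : J → ℕ) ν => y ⟨(N + 1, ν), hJ ν⟩) measurable_id
      (measurable_pi_lambda _ fun ν => measurable_pi_apply _)
  have h2 : IndepFun U (fun ω => (fun i : I => S.success c i.1.1 i.1.2 ω,
      fun ν => S.success c (N + 1) ν ω)) P :=
    hUc.comp (φ := id) (ψ := fun (y : ℕ × V → ℕ) => (fun i : I => y i.1, fun ν => y (N + 1, ν)))
      measurable_id ((measurable_pi_lambda _ fun i => measurable_pi_apply _).prodMk
        (measurable_pi_lambda _ fun ν => measurable_pi_apply _))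
  have h3 := IndepFun.prodMk_of_prodMk hU (measurable_pi_lambda _ fun i : I => hmeas i.1)
    (measurable_pi_lambda _ fun ν => hc.measurable_success (N + 1) ν) h2 h1
  obtain ⟨u, hu, rfl⟩ := hs
  simp only [measureReal_def, ← ENNReal.toReal_mul]
  exact congrArg ENNReal.toReal
    (h3.measure_inter_preimage_eq_mul u {y} hu (measurableSet_singleton y))

variable [DecidableEq V] {T h : ℕ} {K : ℕ → ℝ} {rule : Ξ → ℕ → Record D → Finset V}

/-- Conditioning on the past: the returns in round `n + 1` are independent of the record and of
the decision. -/
lemma IsDelayModel.integral_round (hc : S.IsDelayModel P c) (hU : Measurable U)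
    (hUc : IndepFun U (fun ω (i : ℕ × V) => S.success c i.1 i.2 ω) P)
    (hrule : S.IsOnlineRule T h K rule) (n : ℕ) (F : Record D → Finset V → (V → ℕ) → ℝ) :
    ∫ ω, F (S.record h rule (U ω) (fun τ ν => S.success c τ ν ω) n)
        (rule (U ω) (n + 1) (S.record h rule (U ω) (fun τ ν => S.success c τ ν ω) n))
        (fun ν => S.success c (n + 1) ν ω) ∂P
      = ∫ ω, ∫ ω', F (S.record h rule (U ω) (fun τ ν => S.success c τ ν ω) n)
        (rule (U ω) (n + 1) (S.record h rule (U ω) (fun τ ν => S.success c τ ν ω) n))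
        (fun ν => S.success c (n + 1) ν ω') ∂P ∂P := by
  have hR : FiniteValued (S.past c U n) _ := finiteValued_record hrule le_rfl
  have hA := finiteValued_rule hrule (S.measurable_past c U n) (n + 1) hR
  exact FiniteValued.integral_of_indep (hc.past_le hU n) (hR.prodMk hA)
    (finiteValued_success fun ν => hc.measurable_success (n + 1) ν)
    (fun s hs y => hc.indep_past hU hUc n hs y) fun z y => F z.1 z.2 y

omit [IsProbabilityMeasure P] in
lemma IsDelayModel.finiteValued_record (hc : S.IsDelayModel P c) (hU : Measurable U)
    (hrule : S.IsOnlineRule T h K rule) (n : ℕ) :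
    FiniteValued ‹MeasurableSpace Ω›
      fun ω => S.record h rule (U ω) (fun τ ν => S.success c τ ν ω) n :=
  (System.finiteValued_record hrule le_rfl).mono (hc.past_le hU n)

omit [Fintype V] [DecidableEq V] in
lemma exp_exponent_update (l m : ℝ) (p : Fin D → ℕ) (t : ℕ) (R : Record D) (A : Finset V)
    (y : V → ℕ) : Real.exp ((S.update h t R A y).exponent l m p)
      = Real.exp (R.exponent l m p)
        * ∏ ν ∈ A.filter (fun ν => cell h (S.ctx t ν) = p),
            Real.exp (l * (y ν - m) - l ^ 2 / 8) := by
  rw [← Real.exp_sum, ← Real.exp_add, Finset.sum_sub_distrib, ← Finset.mul_sum,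
    Finset.sum_sub_distrib, Finset.sum_const, Finset.sum_const, nsmul_eq_mul, nsmul_eq_mul]
  simp only [Record.exponent, update]
  push_cast
  ring_nf

/-- Supermartingale step: given the past, each newly selected device of the hypercube multiplies the
exponential by a factor of conditional mean at most one, independently of the others. The hypothesis
`hm` puts `m` on the right side of every mean in the hypercube, as these means need not coincide. -/
lemma IsDelayModel.integral_exp_exponent_le (hc : S.IsDelayModel P c) (hU : Measurable U)
    (hUc : IndepFun U (fun ω (i : ℕ × V) => S.success c i.1 i.2 ω) P)
    (hrule : S.IsOnlineRule T h K rule) {l m : ℝ} {p : Fin D → ℕ}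
    (hm : ∀ x ∈ contextSpace D, cell h x = p → l * (S.succProb x - m) ≤ 0) {n : ℕ} (hn : n ≤ T) :
    ∫ ω, Real.exp ((S.record h rule (U ω) (fun τ ν => S.success c τ ν ω) n).exponent l m p) ∂P
      ≤ 1 := by
  induction n with
  | zero => simp [record, Record.empty, Record.exponent]
  | succ n ih =>
    have hR := hc.finiteValued_record hU hrule n
    have hA := finiteValued_rule hrule hU (n + 1) hR
    refine le_trans ?_ (ih (by omega))
    refine (hc.integral_round hU hUc hrule n fun R A y =>
      Real.exp ((S.update h (n + 1) R A y).exponent l m p)).trans_le ?_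
    refine integral_mono ((hR.prodMk hA).integrable fun z =>
        ∫ ω', Real.exp ((S.update h (n + 1) z.1 z.2
          (fun ν => S.success c (n + 1) ν ω')).exponent l m p) ∂P)
      (hR.integrable fun R => Real.exp (R.exponent l m p)) fun ω => ?_
    simp only [exp_exponent_update]
    rw [integral_const_mul]
    refine mul_le_of_le_one_right (Real.exp_pos _).le
      (integral_prod_exp_bernoulli_le (hc.measurable_success (n + 1)) (hc.iIndepFun_round (n + 1))
        (S.success_eq_zero_or_one c (n + 1)) fun ν hν => ?_)
    rw [Finset.mem_filter] at hν
    have hav := (hrule.choice _ (n + 1) _ (by omega) hn).admissible.1 hν.1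
    rw [hc.prob_success (by omega) hav]
    exact hm _ (S.ctx_mem _ _ hav) hν.2

lemma IsDelayModel.measureReal_exponent_ge_le (hc : S.IsDelayModel P c) (hU : Measurable U)
    (hUc : IndepFun U (fun ω (i : ℕ × V) => S.success c i.1 i.2 ω) P)
    (hrule : S.IsOnlineRule T h K rule) {l m : ℝ} {p : Fin D → ℕ}
    (hm : ∀ x ∈ contextSpace D, cell h x = p → l * (S.succProb x - m) ≤ 0) {n : ℕ} (hn : n ≤ T)
    (a : ℝ) :
    P.real {ω | a ≤
      (S.record h rule (U ω) (fun τ ν => S.success c τ ν ω) n).exponent l m p} ≤ Real.exp (-a) := by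
  have hR := hc.finiteValued_record hU hrule n
  have hmk := mul_meas_ge_le_integral_of_nonneg (μ := P) (ae_of_all _ fun ω => (Real.exp_pos _).le)
    (hR.integrable fun R => Real.exp (R.exponent l m p)) (Real.exp a)
  have := hmk.trans (hc.integral_exp_exponent_le hU hUc hrule hm hn)
  simp only [Real.exp_le_exp] at this
  rw [Real.exp_neg, ← one_div, le_div_iff₀ (Real.exp_pos a), mul_comm]
  exact this

/-- The estimate of a well explored hypercube is accurate with high probability. -/
lemma IsDelayModel.measureReal_inaccurate_le (hc : S.IsDelayModel P c) (hU : Measurable U)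
    (hUc : IndepFun U (fun ω (i : ℕ × V) => S.success c i.1 i.2 ω) P)
    (hrule : S.IsOnlineRule T h K rule) {ρ ε κ : ℝ} (hε : 0 ≤ ε) (hκ : 0 ≤ κ)
    (hρ : ∀ x ∈ contextSpace D, ∀ y ∈ contextSpace D, cell h x = cell h y →
      |S.succProb x - S.succProb y| ≤ ρ)
    {x : EuclideanSpace ℝ (Fin D)} (hx : x ∈ contextSpace D) {n : ℕ} (hn : n ≤ T) :
    P.real {ω | κ < ((S.record h rule (U ω) (fun τ ν => S.success c τ ν ω) n).count (cell h x) : ℝ)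
      ∧ ρ + ε < |(S.record h rule (U ω) (fun τ ν => S.success c τ ν ω) n).estimate (cell h x)
          - S.succProb x|} ≤ 2 * Real.exp (-(2 * κ * ε ^ 2)) := by
  -- `l = 4ε` maximizes `l ε - l ^ 2 / 8`, with value `2 ε ^ 2` per observation. The shift of `m` by
  -- `ρ` absorbs the variation of `succProb` within the hypercube.
  have hup := hc.measureReal_exponent_ge_le hU hUc hrule (l := 4 * ε) (m := S.succProb x + ρ)
    (p := cell h x) (fun y hy hxy => mul_nonpos_of_nonneg_of_nonpos (by positivity)
      (by linarith [(abs_le.1 (hρ y hy x hx hxy)).2])) hn (2 * κ * ε ^ 2)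
  have hlo := hc.measureReal_exponent_ge_le hU hUc hrule (l := -(4 * ε)) (m := S.succProb x - ρ)
    (p := cell h x) (fun y hy hxy => mul_nonpos_of_nonpos_of_nonneg (by linarith)
      (by linarith [(abs_le.1 (hρ y hy x hx hxy)).1])) hn (2 * κ * ε ^ 2)
  refine (measureReal_mono (fun ω hω => ?_)).trans ((measureReal_union_le _ _).trans
    ((add_le_add hup hlo).trans_eq (two_mul _).symm))
  obtain ⟨hcount, hdev⟩ := hω
  simp only [Set.mem_union, Set.mem_ofPred_eq, Record.exponent]
  rw [Record.estimate] at hdev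
  set R := S.record h rule (U ω) (fun τ ν => S.success c τ ν ω) n
  have hpos : (0 : ℝ) < R.count (cell h x) := hκ.trans_lt hcount
  have hκε : κ * ε ^ 2 ≤ R.count (cell h x) * ε ^ 2 :=
    mul_le_mul_of_nonneg_right hcount.le (sq_nonneg _)
  rcases lt_abs.1 hdev with hdev | hdev
  · left
    have h1 : (S.succProb x + ρ + ε) * R.count (cell h x) ≤ R.succ (cell h x) :=
      (le_div_iff₀ hpos).1 (by linarith)
    nlinarith [mul_le_mul_of_nonneg_left h1 hε]
  · right
    have h1 : R.succ (cell h x) ≤ (S.succProb x - ρ - ε) * R.count (cell h x) :=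
      (div_le_iff₀ hpos).1 (by linarith)
    nlinarith [mul_le_mul_of_nonneg_left h1 hε]

end Model

end System

/-! ### Decomposition of the regret -/

namespace System

variable {D : ℕ} {V : Type*} [Fintype V] [DecidableEq V] {S : System D V} {Ω : Type*}
  [MeasurableSpace Ω] {P : Measure Ω} [IsProbabilityMeasure P] {c : ℕ → V → Ω → ℝ}
  {Ξ : Type*} [MeasurableSpace Ξ] {U : Ω → Ξ} {T h : ℕ} {K : ℕ → ℝ}
  {rule : Ξ → ℕ → Record D → Finset V} {best : ℕ → Finset V}

/-- Loss of expected reward by the decision `A` in round `t`, compared to `A'`. -/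
noncomputable def gap (S : System D V) (t : ℕ) (A' A : Finset V) : ℝ :=
  expectedReward (S.threshold t) S.cost (S.deviceProb t) A'
    - expectedReward (S.threshold t) S.cost (S.deviceProb t) A

lemma IsDelayModel.regret_eq (hc : S.IsDelayModel P c) (hU : Measurable U)
    (hUc : IndepFun U (fun ω (i : ℕ × V) => S.success c i.1 i.2 ω) P)
    (hrule : S.IsOnlineRule T h K rule) (hbest : ∀ t, 1 ≤ t → S.Admissible t (best t)) :
    S.regret P c U best T h rule = ∑ t ∈ Finset.Icc 1 T,
      ∫ ω, S.gap t (best t)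
        (S.decision h rule (U ω) (fun τ ν => S.success c τ ν ω) t) ∂P := by
  have hfin : ∀ t ∈ Finset.Icc 1 T, FiniteValued ‹MeasurableSpace Ω›
      fun ω => (S.decision h rule (U ω) (fun τ ν => S.success c τ ν ω) t,
        fun ν => S.success c t ν ω) := fun t _ =>
    (finiteValued_rule hrule hU t (hc.finiteValued_record hU hrule (t - 1))).prodMk
      (finiteValued_success fun ν => hc.measurable_success t ν)
  unfold regret
  rw [integral_finsetSum _ fun t ht => (hfin t ht).integrable fun z =>
    reward (S.threshold t) S.cost z.2 (best t) - reward (S.threshold t) S.cost z.2 z.1]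
  refine Finset.sum_congr rfl fun t ht => ?_
  obtain ⟨ht1, htT⟩ := Finset.mem_Icc.1 ht
  obtain ⟨n, rfl⟩ : ∃ n, t = n + 1 := ⟨t - 1, by omega⟩
  simp only [decision, Nat.add_sub_cancel]
  rw [hc.integral_round hU hUc hrule n fun _ A y =>
    reward (S.threshold (n + 1)) S.cost y (best (n + 1))
      - reward (S.threshold (n + 1)) S.cost y A]
  refine integral_congr_ae (ae_of_all _ fun ω => ?_)
  have hq : FiniteValued ‹MeasurableSpace Ω› fun ω ν => S.success c (n + 1) ν ω :=
    finiteValued_success fun ν => hc.measurable_success (n + 1) ν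
  simp only [gap]
  rw [integral_sub (hq.integrable fun y => reward _ S.cost y _)
    (hq.integrable fun y => reward _ S.cost y _), hc.integral_reward ht1 (hbest _ ht1).1,
    hc.integral_reward ht1 (hrule.choice _ _ _ ht1 htT).admissible.1]

/-- The `O`-statement concerns the absolute value of the regret, so it needs this lower bound too.
-/
lemma IsDelayModel.regret_nonneg (hc : S.IsDelayModel P c) (hU : Measurable U)
    (hUc : IndepFun U (fun ω (i : ℕ × V) => S.success c i.1 i.2 ω) P)
    (hrule : S.IsOnlineRule T h K rule) (hbest : ∀ t, 1 ≤ t → S.IsOptimalDecision t (best t)) :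
    0 ≤ S.regret P c U best T h rule := by
  rw [hc.regret_eq hU hUc hrule fun t ht => (hbest t ht).1]
  refine Finset.sum_nonneg fun t ht => integral_nonneg fun ω => ?_
  obtain ⟨ht1, htT⟩ := Finset.mem_Icc.1 ht
  exact sub_nonneg.2 ((hbest t ht1).2 _ (hrule.choice _ _ _ ht1 htT).admissible)

/-- The estimate of some available device from a well explored hypercube is off by more
than `δ`. -/
def Inaccurate (S : System D V) (h : ℕ) (K : ℕ → ℝ) (δ : ℝ) (t : ℕ) (R : Record D) : Prop :=
  ∃ ν ∈ S.avail t, K t < (R.count (cell h (S.ctx t ν)) : ℝ) ∧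
    δ < |R.estimate (cell h (S.ctx t ν)) - S.succProb (S.ctx t ν)|

omit [Fintype V] in
open Classical in
lemma IsPolicyChoice.gap_le {t : ℕ} {R : Record D} {A A' : Finset V}
    (hA : S.IsPolicyChoice h K t R A) (hA' : S.Admissible t A')
    (hR : ∀ ν, S.deviceEstimate h t R ν ∈ Set.Icc 0 1) {δ N C : ℝ} (hδ : 0 ≤ δ) (hN : 0 ≤ N)
    (hC : 0 ≤ C) (hcard : ∀ B, S.Admissible t B → (B.card : ℝ) ≤ N)
    (hcardC : ∀ B, S.Admissible t B → S.threshold t ≤ B.card → (B.card : ℝ) ≤ C) :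
    S.gap t A' A ≤
      (1 + S.cost * N) *
        ((if (S.underExplored h K t R).Nonempty ∧ 1 ≤ S.budget t then 1 else 0 : ℕ) : ℝ)
      + (1 + S.cost * N) * (if 1 ≤ S.budget t ∧ S.Inaccurate h K δ t R then 1 else 0)
      + 2 * C * δ := by
  have hηN : 0 ≤ 1 + S.cost * N := by have := S.cost_nonneg; positivity
  have hCδ : 0 ≤ 2 * C * δ := by positivity
  have hgap : S.gap t A' A ≤ 1 + S.cost * N :=
    S.gap_le_of_card_le hA.admissible.1 hA'.1 (hcard A hA.admissible)
  rcases Nat.eq_zero_or_pos (S.budget t) with hb | hb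
  · have h0 : ∀ B, S.Admissible t B → B = ∅ := fun B hB =>
      Finset.card_eq_zero.1 (Nat.le_zero.1 (hb ▸ hB.2.2))
    have hzero : S.gap t A' A = 0 := by
      rw [h0 A hA.admissible, h0 A' hA', gap, sub_self]
    simpa [hzero, hb] using hCδ
  by_cases hex : (S.underExplored h K t R).Nonempty
  · rw [if_pos ⟨hex, hb⟩]
    split_ifs <;> push_cast <;> linarith
  by_cases hbad : S.Inaccurate h K δ t R
  · rw [if_neg fun h => hex h.1, if_pos ⟨hb, hbad⟩]
    push_cast
    linarith
  rw [if_neg fun h => hex h.1, if_neg fun h => hbad h.2]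
  rw [Finset.not_nonempty_iff_eq_empty] at hex
  have := (hA.2.2 hex).gap_le hA' hδ hC (fun ν _ => hR ν) (fun ν hν => ?_) hcardC
  · rw [gap]
    push_cast
    linarith
  -- In exploitation no available device is under-explored, so a large error would make the record
  -- `Inaccurate`.
  · by_contra hlt
    refine hbad ⟨ν, hν, ?_, not_le.1 hlt⟩
    by_contra hle
    exact Finset.notMem_empty ν (hex ▸ Finset.mem_filter.2 ⟨hν, not_lt.1 hle⟩)

open Classical in
lemma IsDelayModel.regret_le (hc : S.IsDelayModel P c) (hU : Measurable U)
    (hUc : IndepFun U (fun ω (i : ℕ × V) => S.success c i.1 i.2 ω) P)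
    (hrule : S.IsOnlineRule T h K rule) (hbest : ∀ t, 1 ≤ t → S.Admissible t (best t))
    (hh : 1 ≤ h) {ρ : ℝ} {ε : ℕ → ℝ} (hρ0 : 0 ≤ ρ) (hε : ∀ t, 0 ≤ ε t)
    (hρ : ∀ x ∈ contextSpace D, ∀ y ∈ contextSpace D, cell h x = cell h y →
      |S.succProb x - S.succProb y| ≤ ρ)
    {k : ℕ} (hK0 : ∀ t, 1 ≤ t → 0 ≤ K t) (hK : ∀ t, 1 ≤ t → t ≤ T → K t < k)
    {N C W : ℝ} (hN : 0 ≤ N) (hC : 0 ≤ C) (hW : 0 ≤ W)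
    (hcard : ∀ t, 1 ≤ t → t ≤ T → ∀ B, S.Admissible t B → (B.card : ℝ) ≤ N)
    (hcardC : ∀ t, 1 ≤ t → t ≤ T → ∀ B, S.Admissible t B → S.threshold t ≤ B.card →
      (B.card : ℝ) ≤ C)
    (hcardW : ∀ t, 1 ≤ t → t ≤ T → 1 ≤ S.budget t → (Fintype.card V : ℝ) ≤ W) :
    S.regret P c U best T h rule ≤
      (1 + S.cost * N) * ((h : ℝ) ^ D * k)
      + (1 + S.cost * N) * W * ∑ t ∈ Finset.Icc 1 T, 2 * Real.exp (-(2 * K t * ε t ^ 2))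
      + 2 * C * ∑ t ∈ Finset.Icc 1 T, (ρ + ε t) := by
  have hηN : 0 ≤ 1 + S.cost * N := by have := S.cost_nonneg; positivity
  set R : ℕ → Ω → Record D :=
    fun t ω => S.record h rule (U ω) (fun τ ν => S.success c τ ν ω) (t - 1) with hRdef
  set e : ℕ → Record D → ℕ := fun t R =>
    if (S.underExplored h K t R).Nonempty ∧ 1 ≤ S.budget t then 1 else 0 with he
  set b : ℕ → Record D → ℝ := fun t R =>
    if 1 ≤ S.budget t ∧ S.Inaccurate h K (ρ + ε t) t R then 1 else 0 with hb
  have hRfin : ∀ t, FiniteValued ‹MeasurableSpace Ω› (R t) :=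
    fun t => hc.finiteValued_record hU hrule (t - 1)
  have hexp : ∑ t ∈ Finset.Icc 1 T, ∫ ω, (e t (R t ω) : ℝ) ∂P ≤ (h : ℝ) ^ D * k := by
    rw [← integral_finsetSum _ fun t _ => (hRfin t).integrable fun R => (e t R : ℝ)]
    refine (integral_mono (integrable_finsetSum _ fun t _ =>
      (hRfin t).integrable fun R => (e t R : ℝ)) (integrable_const ((h : ℝ) ^ D * k))
      fun ω => ?_).trans_eq (by simp)
    have := sum_explore_le (q := fun τ ν => S.success c τ ν ω) (ξ := U ω) hh
      (fun t R => hrule.choice (U ω) t R) hK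
    exact_mod_cast this
  have hbad : ∀ t ∈ Finset.Icc 1 T, ∫ ω, b t (R t ω) ∂P
      ≤ W * (2 * Real.exp (-(2 * K t * ε t ^ 2))) := by
    intro t ht
    obtain ⟨ht1, htT⟩ := Finset.mem_Icc.1 ht
    by_cases hb1 : 1 ≤ S.budget t
    · have hind : ∀ ω, b t (R t ω)
          = {ω | S.Inaccurate h K (ρ + ε t) t (R t ω)}.indicator (1 : Ω → ℝ) ω := by
        intro ω
        simp [hb, hb1, Set.indicator_apply]
      simp_rw [hind]
      have hmeas : MeasurableSet {ω | S.Inaccurate h K (ρ + ε t) t (R t ω)} :=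
        (hRfin t).measurableSet_preimage {R | S.Inaccurate h K (ρ + ε t) t R}
      rw [integral_indicator_one hmeas]
      have hunion : {ω | S.Inaccurate h K (ρ + ε t) t (R t ω)} = ⋃ ν ∈ S.avail t,
          {ω | K t < ((R t ω).count (cell h (S.ctx t ν)) : ℝ) ∧
            ρ + ε t < |(R t ω).estimate (cell h (S.ctx t ν)) - S.succProb (S.ctx t ν)|} := by
        ext ω
        simp only [Inaccurate, Set.mem_ofPred_eq, Set.mem_iUnion, exists_prop]
      rw [hunion]
      -- Union bound over the available devices, not over the hypercubes: it costs a factor that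
      -- does not grow with `h`.
      refine (measureReal_biUnion_finset_le _ _).trans ((Finset.sum_le_card_nsmul _ _ _
        fun ν hν => hc.measureReal_inaccurate_le hU hUc hrule (hε t) (hK0 t ht1) hρ
          (S.ctx_mem t ν hν) (by omega)).trans ?_)
      rw [nsmul_eq_mul]
      refine mul_le_mul_of_nonneg_right (le_trans ?_ (hcardW t ht1 htT hb1)) (by positivity)
      exact_mod_cast Finset.card_le_univ _
    · simp only [hb, hb1, false_and, if_false, integral_zero]
      positivity
  rw [hc.regret_eq hU hUc hrule hbest]
  calc _ ≤ ∑ t ∈ Finset.Icc 1 T, ((1 + S.cost * N) * ∫ ω, (e t (R t ω) : ℝ) ∂P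
          + (1 + S.cost * N) * (W * (2 * Real.exp (-(2 * K t * ε t ^ 2))))
          + 2 * C * (ρ + ε t)) := by
        refine Finset.sum_le_sum fun t ht => ?_
        obtain ⟨ht1, htT⟩ := Finset.mem_Icc.1 ht
        have hi1 : Integrable (fun ω => (1 + S.cost * N) * (e t (R t ω) : ℝ)) P :=
          (hRfin t).integrable fun R => (1 + S.cost * N) * (e t R : ℝ)
        have hi12 : Integrable (fun ω => (1 + S.cost * N) * (e t (R t ω) : ℝ)
            + (1 + S.cost * N) * b t (R t ω)) P :=
          (hRfin t).integrable fun R => (1 + S.cost * N) * (e t R : ℝ) + (1 + S.cost * N) * b t R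
        have hi2 : Integrable (fun ω => (1 + S.cost * N) * b t (R t ω)) P :=
          (hRfin t).integrable fun R => (1 + S.cost * N) * b t R
        have hle : ∫ ω, S.gap t (best t)
            (S.decision h rule (U ω) (fun τ ν => S.success c τ ν ω) t) ∂P
            ≤ ∫ ω, ((1 + S.cost * N) * (e t (R t ω) : ℝ) + (1 + S.cost * N) * b t (R t ω)
              + 2 * C * (ρ + ε t)) ∂P := by
          refine integral_mono ((finiteValued_rule hrule hU t (hRfin t)).integrable
            fun A => S.gap t (best t) A) (hi12.add (integrable_const _)) fun ω => ?_
          exact (hrule.choice (U ω) t _ ht1 htT).gap_le (hbest t ht1)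
            (fun ν => deviceEstimate_record_mem (fun τ ν => S.success_le_one c τ ν ω) _ _ _)
            (add_nonneg hρ0 (hε t)) hN hC (hcard t ht1 htT) (hcardC t ht1 htT)
        refine hle.trans ?_
        rw [integral_add hi12 (integrable_const _), integral_add hi1 hi2,
          integral_const_mul, integral_const_mul, integral_const, probReal_univ, one_smul]
        have := mul_le_mul_of_nonneg_left (hbad t ht) hηN
        linarith
    _ = (1 + S.cost * N) * ∑ t ∈ Finset.Icc 1 T, ∫ ω, (e t (R t ω) : ℝ) ∂P
        + (1 + S.cost * N) * W * ∑ t ∈ Finset.Icc 1 T, 2 * Real.exp (-(2 * K t * ε t ^ 2))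
        + 2 * C * ∑ t ∈ Finset.Icc 1 T, (ρ + ε t) := by
        rw [Finset.sum_add_distrib, Finset.sum_add_distrib, Finset.mul_sum, Finset.mul_sum,
          Finset.mul_sum]
        simp only [mul_assoc]
    _ ≤ _ := by
        have := mul_le_mul_of_nonneg_left hexp hηN
        linarith

end System

/-! ### Two sums over rounds -/

section Sums

lemma sum_rpow_neg_le {a : ℝ} (ha0 : 0 ≤ a) (ha1 : a < 1) (T : ℕ) :
    ∑ t ∈ Finset.Icc 1 T, (t : ℝ) ^ (-a) ≤ (T : ℝ) ^ (1 - a) / (1 - a) := by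
  have h1a : 0 < 1 - a := sub_pos.2 ha1
  induction T with
  | zero => simp [Real.zero_rpow h1a.ne']
  | succ n ih =>
    rw [Finset.sum_Icc_succ_top (by omega)]
    refine (add_le_add_left ih _).trans ?_
    rw [le_div_iff₀ h1a, add_mul, div_mul_cancel₀ _ h1a.ne']
    have hpos : (0 : ℝ) < (n + 1 : ℕ) := by exact_mod_cast n.succ_pos
    -- Bernoulli's inequality for `(1 - 1/(n+1)) ^ (1 - a)` replaces the comparison with an
    -- integral.
    have hb := rpow_one_add_le_one_add_mul_self (s := -1 / ((n + 1 : ℕ) : ℝ)) (p := 1 - a)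
      (by rw [le_div_iff₀ hpos]; push_cast; linarith [(Nat.cast_nonneg n : (0 : ℝ) ≤ n)])
      h1a.le (by linarith)
    have hn : (n : ℝ) = (n + 1 : ℕ) * (1 + -1 / ((n + 1 : ℕ) : ℝ)) := by
      field_simp
      push_cast
      ring
    have h0 : (0 : ℝ) ≤ 1 + -1 / ((n + 1 : ℕ) : ℝ) := by
      have : (0 : ℝ) ≤ (n + 1 : ℕ) * (1 + -1 / ((n + 1 : ℕ) : ℝ)) := hn ▸ Nat.cast_nonneg n
      exact nonneg_of_mul_nonneg_right this hpos
    have hmain : (n : ℝ) ^ (1 - a) ≤ ((n + 1 : ℕ) : ℝ) ^ (1 - a)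
        * (1 + (1 - a) * (-1 / ((n + 1 : ℕ) : ℝ))) := by
      conv_lhs => rw [hn]
      rw [Real.mul_rpow hpos.le h0]
      exact mul_le_mul_of_nonneg_left hb (Real.rpow_nonneg hpos.le _)
    have hrp : ((n + 1 : ℕ) : ℝ) ^ (-a) = ((n + 1 : ℕ) : ℝ) ^ (1 - a) / (n + 1 : ℕ) := by
      rw [← Real.rpow_sub_one hpos.ne']
      congr 1
      ring
    rw [hrp]
    calc _ ≤ ((n + 1 : ℕ) : ℝ) ^ (1 - a) * (1 + (1 - a) * (-1 / ((n + 1 : ℕ) : ℝ)))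
        + ((n + 1 : ℕ) : ℝ) ^ (1 - a) / (n + 1 : ℕ) * (1 - a) := by gcongr
      _ = _ := by ring

lemma sum_inv_sq_le (T : ℕ) : ∑ t ∈ Finset.Icc 1 T, 1 / (t : ℝ) ^ 2 ≤ Real.pi ^ 2 / 6 :=
  sum_le_hasSum _ (fun _ _ => by positivity) hasSum_zeta_two

end Sums

/-! ### The choice of `h` and `K` -/

section Parameters

variable {D : ℕ} {α : ℝ}

lemma controlFunction_nonneg (D : ℕ) (α : ℝ) (t : ℕ) : 0 ≤ controlFunction D α t :=
  mul_nonneg (Real.rpow_nonneg (Nat.cast_nonneg _) _) (Real.log_natCast_nonneg t)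

lemma controlFunction_mono (hα : 0 < α) {s t : ℕ} (hs : 1 ≤ s) (hst : s ≤ t) :
    controlFunction D α s ≤ controlFunction D α t := by
  have hst' : (s : ℝ) ≤ t := by exact_mod_cast hst
  have hs' : (0 : ℝ) < s := by exact_mod_cast hs
  exact mul_le_mul (Real.rpow_le_rpow hs'.le hst' (by positivity)) (Real.log_le_log hs' hst')
    (Real.log_natCast_nonneg s) (Real.rpow_nonneg (Nat.cast_nonneg _) _)

lemma exp_controlFunction {t : ℕ} (ht : 1 ≤ t) :
    Real.exp (-(2 * controlFunction D α t * ((t : ℝ) ^ (-(α / (3 * α + D)))) ^ 2))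
      = 1 / (t : ℝ) ^ 2 := by
  have ht' : (0 : ℝ) < t := by exact_mod_cast ht
  have h1 : (t : ℝ) ^ (2 * α / (3 * α + D)) * ((t : ℝ) ^ (-(α / (3 * α + D)))) ^ 2 = 1 := by
    rw [← Real.rpow_natCast, ← Real.rpow_mul ht'.le, ← Real.rpow_add ht']
    have : 2 * α / (3 * α + D) + -(α / (3 * α + D)) * ((2 : ℕ) : ℝ) = 0 := by
      push_cast
      ring
    rw [this, Real.rpow_zero]
  have h2 : -(2 * controlFunction D α t * ((t : ℝ) ^ (-(α / (3 * α + D)))) ^ 2)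
      = -(2 * Real.log t) := by
    rw [controlFunction]
    linear_combination (-2 * Real.log t) * h1
  rw [h2, Real.exp_neg, ← Nat.cast_ofNat, ← Real.log_pow, Real.exp_log (by positivity), one_div]

lemma le_partitionNumber (D : ℕ) (α : ℝ) (T : ℕ) :
    (T : ℝ) ^ (1 / (3 * α + D)) ≤ partitionNumber D α T :=
  Nat.le_ceil _

lemma one_le_rpow_inv (hα : 0 < α) {T : ℕ} (hT : 1 ≤ T) :
    1 ≤ (T : ℝ) ^ (1 / (3 * α + D)) :=
  Real.one_le_rpow (by exact_mod_cast hT) (by positivity)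

lemma one_le_partitionNumber (hα : 0 < α) {T : ℕ} (hT : 1 ≤ T) : 1 ≤ partitionNumber D α T := by
  have := (one_le_rpow_inv (D := D) hα hT).trans (le_partitionNumber D α T)
  exact_mod_cast this

lemma partitionNumber_pow_le (hα : 0 < α) {T : ℕ} (hT : 1 ≤ T) :
    (partitionNumber D α T : ℝ) ^ D ≤ 2 ^ D * (T : ℝ) ^ ((D : ℝ) / (3 * α + D)) := by
  have h1 := one_le_rpow_inv (D := D) hα hT
  -- Rounding up at most doubles a number that is at least one; this is the source of `2 ^ D`.
  have h2 : (partitionNumber D α T : ℝ) ≤ 2 * (T : ℝ) ^ (1 / (3 * α + D)) := by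
    have := (Nat.ceil_lt_add_one (by linarith : 0 ≤ (T : ℝ) ^ (1 / (3 * α + D)))).le
    rw [partitionNumber]
    linarith
  refine (pow_le_pow_left₀ (Nat.cast_nonneg _) h2 D).trans_eq ?_
  rw [mul_pow, ← Real.rpow_natCast ((T : ℝ) ^ _), ← Real.rpow_mul (Nat.cast_nonneg _)]
  congr 2
  ring

lemma rpow_cell_diam_le (hα : 0 < α) {T : ℕ} (hT : 1 ≤ T) :
    (√D / partitionNumber D α T) ^ α
      ≤ (D : ℝ) ^ (α / 2) * (T : ℝ) ^ (-(α / (3 * α + D))) := by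
  have hT0 : (0 : ℝ) < T := by exact_mod_cast hT
  have h1 : (0 : ℝ) < (T : ℝ) ^ (1 / (3 * α + D)) := Real.rpow_pos_of_pos hT0 _
  calc (√D / partitionNumber D α T) ^ α ≤ (√D / (T : ℝ) ^ (1 / (3 * α + D))) ^ α :=
        Real.rpow_le_rpow (by positivity)
          (div_le_div_of_nonneg_left (Real.sqrt_nonneg _) h1 (le_partitionNumber D α T)) hα.le
    _ = _ := by
        rw [Real.div_rpow (Real.sqrt_nonneg _) h1.le, Real.sqrt_eq_rpow,
          ← Real.rpow_mul (Nat.cast_nonneg _), ← Real.rpow_mul hT0.le, div_eq_mul_inv,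
          ← Real.rpow_neg hT0.le]
        congr 2 <;> ring

end Parameters

/-! ### Inserting the parameters -/

namespace System

variable {D : ℕ} {V : Type*} [Fintype V] [DecidableEq V] {S : System D V} {Ω : Type*}
  [MeasurableSpace Ω] {P : Measure Ω} [IsProbabilityMeasure P] {c : ℕ → V → Ω → ℝ}
  {Ξ : Type*} [MeasurableSpace Ξ] {U : Ω → Ξ} {T : ℕ}
  {rule : Ξ → ℕ → Record D → Finset V} {best : ℕ → Finset V}

/-- The regret bound in terms of a bound `N` for the size of the decisions, a bound `C` for the
size of those from which decoding is possible, and a bound `W` for the number of devices in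
rounds with a positive budget. -/
lemma IsDelayModel.regret_le_of_card_le (hc : S.IsDelayModel P c) (hU : Measurable U)
    (hUc : IndepFun U (fun ω (i : ℕ × V) => S.success c i.1 i.2 ω) P) {L α : ℝ} (hL : 0 < L)
    (hα : 0 < α) (hμ : HolderCondition S.succProb L α) (hT : 1 ≤ T)
    (hrule : S.IsOnlineRule T (partitionNumber D α T) (controlFunction D α) rule)
    (hbest : ∀ t, 1 ≤ t → S.Admissible t (best t))
    {N C W : ℝ} (hN : 0 ≤ N) (hC : 0 ≤ C) (hW : 0 ≤ W)
    (hcard : ∀ t, 1 ≤ t → t ≤ T → ∀ B, S.Admissible t B → (B.card : ℝ) ≤ N)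
    (hcardC : ∀ t, 1 ≤ t → t ≤ T → ∀ B, S.Admissible t B → S.threshold t ≤ B.card →
      (B.card : ℝ) ≤ C)
    (hcardW : ∀ t, 1 ≤ t → t ≤ T → 1 ≤ S.budget t → (Fintype.card V : ℝ) ≤ W) :
    S.regret P c U best T (partitionNumber D α T) rule ≤
      (1 + S.cost * N) * 2 ^ D * ((T : ℝ) ^ ((2 * α + D) / (3 * α + D)) * Real.log T
        + (T : ℝ) ^ ((D : ℝ) / (3 * α + D)))
      + (1 + S.cost * N) * W * (Real.pi ^ 2 / 3)
      + (2 * L * (D : ℝ) ^ (α / 2) + (6 * α + 2 * D) / (2 * α + D)) * C *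
        (T : ℝ) ^ ((2 * α + D) / (3 * α + D)) := by
  have hηN : 0 ≤ 1 + S.cost * N := by have := S.cost_nonneg; positivity
  have hT0 : (0 : ℝ) < T := by exact_mod_cast hT
  have hβ : 0 < 3 * α + D := by positivity
  have hh := one_le_partitionNumber (D := D) hα hT
  set a := α / (3 * α + D) with ha
  have ha0 : 0 ≤ a := by positivity
  have h1a : 1 - a = (2 * α + D) / (3 * α + D) := by
    rw [ha]
    field_simp
    ring
  have ha1 : a < 1 := by
    have : 0 < (2 * α + D) / (3 * α + D) := by positivity
    linarith
  -- The tolerance `t ^ (-a)` matches the order `T ^ (-a)` of the Hölder error. The `+ 1` in `k`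
  -- makes the bound on `K t` strict.
  have hmain := hc.regret_le (ε := fun t => (t : ℝ) ^ (-a))
    (k := ⌊controlFunction D α T⌋₊ + 1) hU hUc hrule hbest hh
    (by positivity : 0 ≤ L * (√D / partitionNumber D α T) ^ α)
    (fun t => Real.rpow_nonneg (Nat.cast_nonneg _) _)
    (fun x hx y hy hxy => hμ.abs_sub_le_of_cell_eq hL.le hα.le hh hx hy hxy)
    (fun t _ => controlFunction_nonneg D α t)
    (fun t ht1 htT => (controlFunction_mono hα ht1 htT).trans_lt
      (by exact_mod_cast Nat.lt_floor_add_one (controlFunction D α T)))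
    hN hC hW hcard hcardC hcardW
  refine hmain.trans (add_le_add (add_le_add ?_ ?_) ?_)
  · rw [mul_assoc]
    refine mul_le_mul_of_nonneg_left ?_ hηN
    have hk : ((⌊controlFunction D α T⌋₊ + 1 : ℕ) : ℝ) ≤ controlFunction D α T + 1 := by
      push_cast
      linarith [Nat.floor_le (controlFunction_nonneg D α T)]
    refine (mul_le_mul (partitionNumber_pow_le hα hT) hk (Nat.cast_nonneg _)
      (by positivity)).trans_eq ?_
    have hadd : (T : ℝ) ^ ((2 * α + D) / (3 * α + D))
        = (T : ℝ) ^ ((D : ℝ) / (3 * α + D)) * (T : ℝ) ^ (2 * α / (3 * α + D)) := by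
      rw [← Real.rpow_add hT0]
      congr 1
      ring
    rw [hadd, controlFunction]
    ring
  · refine mul_le_mul_of_nonneg_left ?_ (mul_nonneg hηN hW)
    rw [← Finset.mul_sum, Finset.sum_congr rfl fun t ht =>
      exp_controlFunction (D := D) (α := α) (Finset.mem_Icc.1 ht).1]
    linarith [sum_inv_sq_le T]
  · rw [Finset.sum_add_distrib, Finset.sum_const, Nat.card_Icc, Nat.add_sub_cancel, nsmul_eq_mul]
    have h1 := sum_rpow_neg_le ha0 ha1 T
    have h2 : (T : ℝ) * (L * (√D / partitionNumber D α T) ^ α)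
        ≤ L * (D : ℝ) ^ (α / 2) * (T : ℝ) ^ (1 - a) := by
      have hTa : (T : ℝ) ^ (1 - a) = T * (T : ℝ) ^ (-a) := by
        rw [sub_eq_add_neg, Real.rpow_add hT0, Real.rpow_one]
      rw [hTa]
      calc _ ≤ (T : ℝ) * (L * ((D : ℝ) ^ (α / 2) * (T : ℝ) ^ (-a))) := by
            gcongr
            exact rpow_cell_diam_le hα hT
        _ = _ := by ring
    -- The second constant is `2 / (1 - a) = (6α + 2D) / (2α + D)`.
    refine (mul_le_mul_of_nonneg_left (add_le_add h2 h1) (by positivity)).trans_eq ?_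
    rw [h1a]
    field_simp
    ring

end System

end CodedEdge

/-! ### Asymptotics and the theorem -/

lemma CodedEdge.rpow_mul_log_div_tendsto_zero {D : ℕ} {α : ℝ} (hα : 0 < α) :
    Tendsto (fun T : ℕ => (T : ℝ) ^ ((2 * α + D) / (3 * α + D)) * Real.log T / T) atTop (𝓝 0) := by
  have ha : 0 < α / (3 * α + D) := by positivity
  have h1 := (isLittleO_log_rpow_atTop ha).tendsto_div_nhds_zero.comp
    tendsto_natCast_atTop_atTop
  refine h1.congr' ?_
  filter_upwards [eventually_ge_atTop 1] with T hT
  have hT0 : (0 : ℝ) < T := by exact_mod_cast hT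
  have e : (2 * α + D) / (3 * α + D) = 1 + -(α / (3 * α + D)) := by
    field_simp
    ring
  rw [e, Real.rpow_add hT0, Real.rpow_one, Real.rpow_neg hT0.le, Function.comp_apply]
  field_simp

theorem theorem1 {D : ℕ} {V : Type*} [Fintype V] [DecidableEq V]
    (S : CodedEdge.System D V) (L α : ℝ) (hL : 0 < L) (hα : 0 < α)
    (hμ : CodedEdge.HolderCondition S.succProb L α)
    {Ω : Type*} [MeasurableSpace Ω] (P : Measure Ω) [IsProbabilityMeasure P]
    (c : ℕ → V → Ω → ℝ) (hc : S.IsDelayModel P c)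
    {Ξ : Type*} [MeasurableSpace Ξ] (U : Ω → Ξ) (hU : Measurable U)
    (hUc : IndepFun U (fun ω (i : ℕ × V) => S.success c i.1 i.2 ω) P)
    (best : ℕ → Finset V) (hbest : ∀ t, 1 ≤ t → S.IsOptimalDecision t (best t))
    (rule : ℕ → Ξ → ℕ → CodedEdge.Record D → Finset V)
    (hrule : ∀ T, 1 ≤ T → S.IsOnlineRule T (CodedEdge.partitionNumber D α T)
      (CodedEdge.controlFunction D α) (rule T)) :
    (∀ T : ℕ, 1 ≤ T →
      S.regret P c U best T (CodedEdge.partitionNumber D α T) (rule T) ≤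
        (1 + S.cost * S.maxBudget T) * 2 ^ D *
            ((T : ℝ) ^ ((2 * α + D) / (3 * α + D)) * Real.log T
              + (T : ℝ) ^ ((D : ℝ) / (3 * α + D)))
          + (1 + S.cost * S.maxBudget T) * S.maxBudget T * (Real.pi ^ 2 / 3) *
            ∑ k ∈ Finset.Icc 1 (S.maxBudget T), ((Fintype.card V).choose k : ℝ)
          + (3 * L * (D : ℝ) ^ (α / 2) + (6 * α + 2 * D) / (2 * α + D)) *
            S.maxBudget T * S.maxChoose T * (T : ℝ) ^ ((2 * α + D) / (3 * α + D))) ∧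
    (fun T : ℕ => S.regret P c U best T (CodedEdge.partitionNumber D α T) (rule T))
      =O[atTop] (fun T : ℕ => (T : ℝ) ^ ((2 * α + D) / (3 * α + D)) * Real.log T) ∧
    Tendsto (fun T : ℕ =>
        S.regret P c U best T (CodedEdge.partitionNumber D α T) (rule T) / T)
      atTop (𝓝 0) := by
  have hadm : ∀ t, 1 ≤ t → S.Admissible t (best t) := fun t ht => (hbest t ht).1
  have hO : (fun T : ℕ => S.regret P c U best T (CodedEdge.partitionNumber D α T) (rule T))
      =O[atTop] (fun T : ℕ => (T : ℝ) ^ ((2 * α + D) / (3 * α + D)) * Real.log T) := by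
    -- `maxBudget T` and `maxChoose T` may grow with `T`, so the explicit bound does not give the
    -- rate; `|V|` bounds all sizes uniformly in `T`.
    obtain ⟨n, hn⟩ : ∃ n : ℝ, n = Fintype.card V := ⟨_, rfl⟩
    have hn0 : 0 ≤ n := hn ▸ Nat.cast_nonneg _
    set A₁ : ℝ := (1 + S.cost * n) * 2 ^ D
    set A₂ : ℝ := (1 + S.cost * n) * n * (Real.pi ^ 2 / 3)
    set A₃ : ℝ := (2 * L * (D : ℝ) ^ (α / 2) + (6 * α + 2 * D) / (2 * α + D)) * n
    have hη := S.cost_nonneg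
    have hA₁ : 0 ≤ A₁ := by positivity
    have hA₂ : 0 ≤ A₂ := by positivity
    have hA₃ : 0 ≤ A₃ := by positivity
    refine IsBigO.of_bound (A₁ * 2 + A₂ + A₃) ?_
    filter_upwards [eventually_ge_atTop 3] with T hT
    have hT1 : (1 : ℝ) ≤ T := by exact_mod_cast (by omega : 1 ≤ T)
    have hlog : 1 ≤ Real.log T := by
      rw [Real.le_log_iff_exp_le (by linarith)]
      refine Real.exp_one_lt_d9.le.trans ?_
      have : (3 : ℝ) ≤ T := by exact_mod_cast hT
      linarith
    have hcardn : ∀ B : Finset V, (B.card : ℝ) ≤ n := fun B => by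
      rw [hn]
      exact_mod_cast Finset.card_le_univ B
    have hle := hc.regret_le_of_card_le hU hUc hL hα hμ (by omega) (hrule T (by omega)) hadm
      hn0 hn0 hn0 (fun _ _ _ B _ => hcardn B)
      (fun _ _ _ B _ _ => hcardn B) (fun _ _ _ _ => hn.ge)
    have h1 : 1 ≤ (T : ℝ) ^ ((2 * α + D) / (3 * α + D)) := Real.one_le_rpow hT1 (by positivity)
    have h2 : (T : ℝ) ^ ((D : ℝ) / (3 * α + D)) ≤ (T : ℝ) ^ ((2 * α + D) / (3 * α + D)) :=
      Real.rpow_le_rpow_of_exponent_le hT1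
        (div_le_div_of_nonneg_right (by linarith) (by positivity))
    have h3 : (T : ℝ) ^ ((2 * α + D) / (3 * α + D))
        ≤ (T : ℝ) ^ ((2 * α + D) / (3 * α + D)) * Real.log T :=
      le_mul_of_one_le_right (by linarith) hlog
    rw [Real.norm_of_nonneg (hc.regret_nonneg hU hUc (hrule T (by omega)) hbest),
      Real.norm_of_nonneg (by linarith)]
    change _ ≤ A₁ * ((T : ℝ) ^ ((2 * α + D) / (3 * α + D)) * Real.log T
      + (T : ℝ) ^ ((D : ℝ) / (3 * α + D))) + A₂
      + A₃ * (T : ℝ) ^ ((2 * α + D) / (3 * α + D)) at hle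
    have g1 := mul_le_mul_of_nonneg_left (h2.trans h3) hA₁
    have g2 := mul_le_mul_of_nonneg_left (h1.trans h3) hA₂
    have g3 := mul_le_mul_of_nonneg_left h3 hA₃
    linarith only [hle, g1, g2, g3]
  refine ⟨fun T hT => ?_, hO, ?_⟩
  · set B := S.maxBudget T
    set M := S.maxChoose T
    have hη := S.cost_nonneg
    have hbudget : ∀ t, 1 ≤ t → t ≤ T → S.budget t ≤ B := fun t ht1 htT =>
      Finset.le_sup (f := S.budget) (Finset.mem_Icc.2 ⟨ht1, htT⟩)
    -- `C = B * M` is valid because a set that can decode forces `threshold ≤ B`, hence `M ≥ 1`;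
    -- otherwise `M` may vanish. `W` works because the term `k = 1` of the sum is `|V|`, present
    -- once `B ≥ 1`.
    have hle := hc.regret_le_of_card_le hU hUc hL hα hμ hT (hrule T hT) hadm
      (N := B) (C := B * M) (W := B * ∑ k ∈ Finset.Icc 1 B, ((Fintype.card V).choose k : ℝ))
      (by positivity) (by positivity) (by positivity)
      (fun t ht1 htT A hA => by exact_mod_cast hA.2.2.trans (hbudget t ht1 htT))
      (fun t ht1 htT A hA hY => by
        have hAB := hA.2.2.trans (hbudget t ht1 htT)
        have hM : 1 ≤ M := (Nat.choose_pos (by omega)).trans_le (Finset.le_sup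
          (f := fun t => (B - 1).choose (S.threshold t - 1)) (Finset.mem_Icc.2 ⟨ht1, htT⟩))
        exact_mod_cast hAB.trans (Nat.le_mul_of_pos_right B hM))
      (fun t ht1 htT hb => by
        have hB : 1 ≤ B := hb.trans (hbudget t ht1 htT)
        have h1 : Fintype.card V ≤ ∑ k ∈ Finset.Icc 1 B, (Fintype.card V).choose k := by
          conv_lhs => rw [← Nat.choose_one_right (Fintype.card V)]
          exact Finset.single_le_sum (f := fun k => (Fintype.card V).choose k)
            (fun _ _ => Nat.zero_le _) (Finset.mem_Icc.2 ⟨le_rfl, hB⟩)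
        exact_mod_cast h1.trans (Nat.le_mul_of_pos_left _ hB))
    -- The slack between the proved constant `2L` and the stated `3L`.
    have h3 : 0 ≤ L * (D : ℝ) ^ (α / 2) * (B * M * (T : ℝ) ^ ((2 * α + D) / (3 * α + D))) := by
      positivity
    refine hle.trans ?_
    linarith
  · exact (hO.mul (isBigO_refl (fun T : ℕ => (T : ℝ)⁻¹) atTop)).trans_tendsto
      (CodedEdge.rpow_mul_log_div_tendsto_zero hα)
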